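/- Let $\Sigma$ be a fan in $\mathbb R^n$: a non-empty finite collection of strongly convex rational polyhedral cones (generated by finitely many vectors of $\mathbb Z^n$) that contains every face of each of its cones and in which any two cones meet in a common face. Let $T=(\mathbb C^*)^n$, identified with $i\mathbb Z^n\backslash\mathbb C^n$ by $\mathbf z\mapsto e^{-2\pi\mathbf z}$. Let $X_\Sigma$ be the toric variety of $\Sigma$ with its analytic topology. That is, for each $\sigma\in\Sigma$ let $\mathbf m_1,\dots,\mathbf m_k$ be any finite system of generators of the semigroup $\sigma^\vee\cap\mathbb Z^n$, let $U_\sigma\subseteq\mathbb C^k$ be the Zariski closure of the image of $T\to\mathbb C^k$, $\mathbf t\mapsto(\mathbf t^{\mathbf m_1},\dots,\mathbf t^{\mathbf m_k})$, and glue the $U_\sigma$ (with the topology of $\mathbb C^k$) along the inclusions $U_\tau\subseteq U_\sigma$ for $\tau$ a face of $\sigma$. The torus $T$ acts on $U_\sigma$ by $\mathbf t\cdot w=(\mathbf t^{\mathbf m_i}w_i)_i$, hence on $X_\Sigma$. Let $\mathrm{orb}(\sigma)=T\cdot x_\sigma$ be the orbit of the distinguished point $x_\sigma\in U_\sigma$,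 whose $i$-th coordinate is $1$ if $\mathbf m_i$ vanishes on $\sigma$ and $0$ otherwise. For $\sigma\in\Sigma$ let $O(\sigma)=i\mathbb Z^n\backslash\mathbb C^n/\mathrm{Span}_{\mathbb C}(\sigma)$ with the quotient topology, so that $O(\{0\})=T$, and let $$\overline T_\Sigma=T\sqcup\coprod_{\sigma\in\Sigma,\ \sigma\ne\{0\}}O(\sigma),$$ on which $T=i\mathbb Z^n\backslash\mathbb C^n$ acts by translation on each component. Say that a sequence $\mathbf z_j=\mathbf x_j+i\mathbf y_j$ in $T$ is $\sigma$-convergent to $p\in O(\sigma)$ if 1. $\mathbf x_j=\mathbf x_j'+\mathbf x_j''$, where $\mathbf x_j'$ lies in the relative interior of $\sigma$ and its distance to the relative boundary of $\sigma$ tends to $+\infty$ (a condition that is empty for $\sigma=\{0\}$), and $\mathbf x_j''$ is bounded; and 2. the image of $\mathbf z_j$ in $O(\sigma)$ converges to $p$. Give $\overline T_\Sigma$ the coarsest topology in which, for every $A\subseteq T$, the set of all points $p\in O(\sigma)$, $\sigma\in\Sigma$, to which some sequence in $A$ is $\sigma$-convergent is closed. **Proposition.** In this topology a sequence in $T$ converges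 to a point $p\in O(\sigma)$ if and only if it is $\sigma$-convergent to $p$. The identity map of $T$ extends to a homeomorphism $X_\Sigma\to\overline T_\Sigma$ that is equivariant with respect to the actions of $T$ and maps each orbit $\mathrm{orb}(\sigma)$, $\sigma\in\Sigma$, homeomorphically onto the component $O(\sigma)$ with its quotient topology. -/

import Mathlib

open Filter Topology

noncomputable section

namespace Toric

/-! ### Cones and fans -/

/-- Euclidean space `ℝⁿ`. -/
abbrev E (n : ℕ) : Type := EuclideanSpace ℝ (Fin n)

/-- A vector of the standard lattice `ℤⁿ`, seen in `ℝⁿ`. -/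
def latticeVec {n : ℕ} (u : Fin n → ℤ) : E n := WithLp.toLp 2 fun l => (u l : ℝ)

/-- A rational polyhedral cone: generated by finitely many vectors of `ℤⁿ`. -/
def IsRationalPolyhedral {n : ℕ} (σ : PointedCone ℝ (E n)) : Prop :=
  ∃ S : Finset (Fin n → ℤ), σ = PointedCone.hull ℝ (latticeVec '' (S : Set (Fin n → ℤ)))

/-- Strong convexity: `σ ∩ -σ = {0}`. -/
def IsStronglyConvex {n : ℕ} (σ : PointedCone ℝ (E n)) : Prop :=
  ∀ x ∈ σ, -x ∈ σ → x = 0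

/-- `τ` is a face of `σ`: the intersection of `σ` with the zero set of a linear functional that is
nonnegative on `σ`. -/
def IsFace {n : ℕ} (τ σ : PointedCone ℝ (E n)) : Prop :=
  ∃ f : E n →ₗ[ℝ] ℝ, (∀ x ∈ σ, 0 ≤ f x) ∧ ∀ x, x ∈ τ ↔ x ∈ σ ∧ f x = 0

/-- A (finite) fan in `ℝⁿ`. The last field says that the fan contains the trivial cone `{0}`;
as `{0}` is a face of every strongly convex polyhedral cone, it only excludes the empty
collection. -/
structure Fan (n : ℕ) where
  cones : Set (PointedCone ℝ (E n))
  finite : cones.Finite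
  rational : ∀ σ ∈ cones, IsRationalPolyhedral σ
  stronglyConvex : ∀ σ ∈ cones, IsStronglyConvex σ
  face_mem : ∀ σ ∈ cones, ∀ τ, IsFace τ σ → τ ∈ cones
  inter_face : ∀ σ ∈ cones, ∀ τ ∈ cones, IsFace (σ ⊓ τ) σ ∧ IsFace (σ ⊓ τ) τ
  zero_mem : ⊥ ∈ cones

/-- The trivial cone `{0}` as a member of the fan. -/
def Fan.zero {n : ℕ} (F : Fan n) : F.cones := ⟨⊥, F.zero_mem⟩

/-- The semigroup `σ^∨ ∩ ℤⁿ` of lattice points of the dual cone. -/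
def dualMonoid {n : ℕ} (σ : PointedCone ℝ (E n)) : AddSubmonoid (Fin n → ℤ) where
  carrier := {m | ∀ u ∈ σ, 0 ≤ ∑ l, (m l : ℝ) * u l}
  zero_mem' := by intro u _; simp
  add_mem' := by
    intro a b ha hb u hu
    have h1 := ha u hu
    have h2 := hb u hu
    simp only [Pi.add_apply, Int.cast_add, add_mul, Finset.sum_add_distrib]
    exact add_nonneg h1 h2

/-! ### The torus and affine toric varieties -/

/-- The complex torus `T = (ℂ*)ⁿ`. -/
abbrev Torus (n : ℕ) : Type := Fin n → ℂˣ

/-- The Laurent monomial `t ^ m = ∏ t_l ^ {m_l}`. -/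
def monomial {n : ℕ} (m : Fin n → ℤ) (t : Torus n) : ℂˣ := ∏ l, t l ^ m l

theorem monomial_mul {n : ℕ} (m : Fin n → ℤ) (s t : Torus n) :
    monomial m (s * t) = monomial m s * monomial m t := by
  simp [monomial, mul_zpow, Finset.prod_mul_distrib]

theorem monomial_one {n : ℕ} (m : Fin n → ℤ) : monomial m (1 : Torus n) = 1 := by
  simp [monomial]

theorem monomial_sum {n k : ℕ} (a : Fin k → ℕ) (m : Fin k → Fin n → ℤ) (t : Torus n) :
    monomial (∑ j, a j • m j) t = ∏ j, monomial (m j) t ^ a j := by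
  simp only [monomial, Finset.sum_apply, Pi.smul_apply, ← Finset.prod_pow]
  rw [Finset.prod_comm]
  refine Finset.prod_congr rfl fun l _ => ?_
  induction (Finset.univ : Finset (Fin k)) using Finset.induction_on with
  | empty => simp
  | insert j s hj ih =>
    rw [Finset.sum_insert hj, Finset.prod_insert hj, zpow_add, ih, nsmul_eq_mul,
      mul_comm (a j : ℤ), zpow_mul, zpow_natCast]

/-- The Zariski closure of a subset of `ℂᵏ`: the common zeros of all polynomials that vanish
on it. -/
def zariskiClosure {k : ℕ} (A : Set (Fin k → ℂ)) : Set (Fin k → ℂ) :=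
  {w | ∀ p : MvPolynomial (Fin k) ℂ,
    (∀ v ∈ A, MvPolynomial.eval v p = 0) → MvPolynomial.eval w p = 0}

/-- The map `φ : (ℂ*)ⁿ → ℂᵏ`, `t ↦ (t ^ m₁, …, t ^ m_k)`. -/
def torusMap {n k : ℕ} (m : Fin k → Fin n → ℤ) (t : Torus n) : Fin k → ℂ :=
  fun i => (monomial (m i) t : ℂ)

/-- The affine toric variety given by `m₁, …, m_k`, with the topology induced from `ℂᵏ` (the
analytic topology). -/
def affineToric {n k : ℕ} (m : Fin k → Fin n → ℤ) : Set (Fin k → ℂ) :=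
  zariskiClosure (Set.range (torusMap m))

theorem torusMap_mem {n k : ℕ} (m : Fin k → Fin n → ℤ) (t : Torus n) :
    torusMap m t ∈ affineToric m :=
  fun _ hp => hp _ ⟨t, rfl⟩

/-- `T` acts on `ℂᵏ` through the characters `m₁, …, m_k`; this preserves the affine toric
variety. -/
theorem smul_mem_affineToric {n k : ℕ} (m : Fin k → Fin n → ℤ) (t : Torus n)
    {w : Fin k → ℂ} (hw : w ∈ affineToric m) :
    (fun i => (monomial (m i) t : ℂ) * w i) ∈ affineToric m := by
  intro p hp
  have key : ∀ v : Fin k → ℂ,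
      MvPolynomial.eval v (MvPolynomial.bind₁
        (fun i => MvPolynomial.C (monomial (m i) t : ℂ) * MvPolynomial.X i) p) =
      MvPolynomial.eval (fun i => (monomial (m i) t : ℂ) * v i) p := by
    intro v
    rw [← MvPolynomial.coe_aeval_eq_eval, ← MvPolynomial.coe_aeval_eq_eval]
    simp only [RingHom.coe_coe, MvPolynomial.aeval_bind₁]
    congr 2
    funext i
    simp
  rw [← key]
  apply hw
  rintro _ ⟨s, rfl⟩
  rw [key]
  apply hp
  refine ⟨t * s, ?_⟩
  funext i
  simp [torusMap, monomial_mul]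

/-- For every cone of the fan, a finite system of generators of the semigroup `σ^∨ ∩ ℤⁿ`. -/
structure Generators {n : ℕ} (F : Fan n) where
  k : F.cones → ℕ
  m : (σ : F.cones) → Fin (k σ) → Fin n → ℤ
  closure_eq : ∀ σ, AddSubmonoid.closure (Set.range (m σ)) = dualMonoid σ.1

theorem mem_dualMonoid_hull {n : ℕ} (S : Finset (Fin n → ℤ)) (m : Fin n → ℤ) :
    m ∈ dualMonoid (PointedCone.hull ℝ (latticeVec '' (S : Set (Fin n → ℤ)))) ↔
      ∀ u ∈ S, 0 ≤ ∑ l, m l * u l := by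
  constructor
  · intro h u hu
    have := h (latticeVec u) (Submodule.subset_span ⟨u, hu, rfl⟩)
    simp only [latticeVec] at this
    exact_mod_cast this
  · intro h x hx
    induction hx using Submodule.span_induction with
    | mem x hx =>
      obtain ⟨u, hu, rfl⟩ := hx
      simp only [latticeVec]
      exact_mod_cast h u hu
    | zero => simp
    | add x y _ _ hx hy =>
      simp only [PiLp.add_apply, mul_add, Finset.sum_add_distrib]
      exact add_nonneg hx hy
    | smul a x _ hx =>
      have : ∑ l, (m l : ℝ) * (a • x) l = a * ∑ l, (m l : ℝ) * x l := by
        rw [Finset.mul_sum]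
        refine Finset.sum_congr rfl fun l _ => ?_
        change (m l : ℝ) * ((a : ℝ) * x l) = _
        ring
      rw [this]
      exact mul_nonneg a.2 hx

/-- Systems of generators exist. -/
theorem dualMonoid_fg {n : ℕ} {σ : PointedCone ℝ (E n)} (hσ : IsRationalPolyhedral σ) :
    (dualMonoid σ).FG := by
  obtain ⟨S, rfl⟩ := hσ
  let pr : (((Fin n → ℕ) × (Fin n → ℕ)) × (S → ℕ)) →+ (Fin n → ℤ) :=
    { toFun := fun x l => (x.1.1 l : ℤ) - x.1.2 l
      map_zero' := by funext l; simp
      map_add' := by intro x y; funext l; simp; ring }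
  let f : (((Fin n → ℕ) × (Fin n → ℕ)) × (S → ℕ)) →+ (S → ℤ) :=
    { toFun := fun x u => ∑ l, pr x l * u.1 l
      map_zero' := by funext u; simp
      map_add' := by
        intro x y; funext u
        simp [add_mul, Finset.sum_add_distrib] }
  let g : (((Fin n → ℕ) × (Fin n → ℕ)) × (S → ℕ)) →+ (S → ℤ) :=
    { toFun := fun x u => (x.2 u : ℤ)
      map_zero' := by funext u; simp
      map_add' := by intro x y; funext u; simp }
  have h := (AddSubmonoid.fg_eqLocusM f g).map pr
  convert h using 1
  ext m
  rw [mem_dualMonoid_hull]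
  constructor
  · intro hm
    refine ⟨((fun l => (m l).toNat, fun l => (-m l).toNat),
      fun u => (∑ l, m l * u.1 l).toNat), ?_, ?_⟩
    · have hpr : ∀ l, ((m l).toNat : ℤ) - ((-m l).toNat : ℤ) = m l := fun l => by omega
      change f _ = g _
      funext u
      change ∑ l, (((m l).toNat : ℤ) - ((-m l).toNat : ℤ)) * u.1 l =
        ((∑ l, m l * u.1 l).toNat : ℤ)
      rw [Int.toNat_of_nonneg (hm u.1 u.2)]
      exact Finset.sum_congr rfl fun l _ => by rw [hpr l]
    · funext l
      change ((m l).toNat : ℤ) - ((-m l).toNat : ℤ) = m l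
      omega
  · rintro ⟨x, hx, rfl⟩ u hu
    have h1 : f x ⟨u, hu⟩ = g x ⟨u, hu⟩ := congrFun (show f x = g x from hx) ⟨u, hu⟩
    change 0 ≤ f x ⟨u, hu⟩
    rw [h1]
    exact Int.natCast_nonneg _

instance {n : ℕ} (F : Fan n) : Nonempty (Generators F) := by
  have h : ∀ σ : F.cones, ∃ (k : ℕ) (m : Fin k → Fin n → ℤ),
      AddSubmonoid.closure (Set.range m) = dualMonoid σ.1 := by
    intro σ
    obtain ⟨S, hS⟩ := dualMonoid_fg (F.rational σ.1 σ.2)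
    refine ⟨S.card, fun i => (S.equivFin.symm i : Fin n → ℤ), ?_⟩
    rw [← hS]
    congr 1
    ext x
    constructor
    · rintro ⟨i, rfl⟩
      exact (S.equivFin.symm i).2
    · intro hx
      exact ⟨S.equivFin ⟨x, hx⟩, by simp⟩
  choose k m hm using h
  exact ⟨⟨k, m, hm⟩⟩

/-! ### The toric variety -/

section Variety

variable {n : ℕ} {F : Fan n}

/-- The affine chart `U_σ`. -/
abbrev Generators.chart (G : Generators F) (σ : F.cones) : Type := affineToric (G.m σ)

/-- The action of `t ∈ T` on the chart `U_σ`. -/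
def Generators.act (G : Generators F) (σ : F.cones) (t : Torus n) (w : G.chart σ) : G.chart σ :=
  ⟨fun i => (monomial (G.m σ i) t : ℂ) * w.1 i, smul_mem_affineToric _ t w.2⟩

/-- For a face `τ` of `σ` every generator `m_i` of `σ^∨ ∩ ℤⁿ` is a combination `∑ a_j m'_j` of the
generators `m'_j` of `τ^∨ ∩ ℤⁿ`. The inclusion `U_τ ⊆ U_σ`, which is the identity on `T`, is the
monomial map with coordinates `u_i = ∏ w_j ^ a_j`. The relation `Glue` identifies `w ∈ U_τ` with
its image `u ∈ U_σ`. -/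
inductive Generators.Glue (G : Generators F) :
    (Σ σ : F.cones, G.chart σ) → (Σ σ : F.cones, G.chart σ) → Prop
  | face (τ σ : F.cones) (w : G.chart τ) (u : G.chart σ) (hface : IsFace τ.1 σ.1)
      (himage : ∀ (i : Fin (G.k σ)) (a : Fin (G.k τ) → ℕ),
        G.m σ i = ∑ j, a j • G.m τ j → u.1 i = ∏ j, w.1 j ^ a j) :
      G.Glue ⟨τ, w⟩ ⟨σ, u⟩

/-- The toric variety `X_Σ`, as a topological space: the charts `U_σ ⊆ ℂᵏ` with their analytic
topology, glued along the inclusions `U_τ ⊆ U_σ` (`Quot` passes to the quotient by the equivalence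
relation that `Glue` generates). -/
def ToricVariety (G : Generators F) : Type := Quot G.Glue

namespace ToricVariety

/-- The quotient topology of the disjoint union of the charts. -/
instance (G : Generators F) : TopologicalSpace (ToricVariety G) :=
  inferInstanceAs (TopologicalSpace (Quot G.Glue))

/-- The point of `X_Σ` given by a point of a chart. -/
def mk (G : Generators F) (σ : F.cones) (w : G.chart σ) : ToricVariety G :=
  Quot.mk _ ⟨σ, w⟩

/-- The inclusion `T ⊆ X_Σ`, through the chart of the trivial cone. -/
def ofTorus (G : Generators F) (t : Torus n) : ToricVariety G :=
  mk G F.zero ⟨torusMap (G.m F.zero) t, torusMap_mem _ t⟩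

theorem glue_act (G : Generators F) (t : Torus n) (x y : Σ σ : F.cones, G.chart σ)
    (h : G.Glue x y) : G.Glue ⟨x.1, G.act x.1 t x.2⟩ ⟨y.1, G.act y.1 t y.2⟩ := by
  obtain ⟨τ, σ, w, u, hf, hu⟩ := h
  refine .face τ σ _ _ hf fun i a ha => ?_
  simp only [Generators.act, mul_pow, Finset.prod_mul_distrib]
  rw [hu i a ha, ha, monomial_sum]
  simp

/-- The action of `T` on `X_Σ`. -/
instance (G : Generators F) : MulAction (Torus n) (ToricVariety G) where
  smul t := Quot.map (fun x => ⟨x.1, G.act x.1 t x.2⟩) (glue_act G t)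
  one_smul x := by
    induction x using Quot.ind with
    | _ x =>
      obtain ⟨σ, w⟩ := x
      change Quot.mk _ (⟨σ, G.act σ 1 w⟩ : Σ σ : F.cones, G.chart σ) = Quot.mk _ ⟨σ, w⟩
      have : G.act σ 1 w = w := by
        apply Subtype.ext
        funext i
        simp [Generators.act, monomial_one]
      rw [this]
  mul_smul s t x := by
    induction x using Quot.ind with
    | _ x =>
      obtain ⟨σ, w⟩ := x
      change Quot.mk _ (⟨σ, G.act σ (s * t) w⟩ : Σ σ : F.cones, G.chart σ) =
        Quot.mk _ ⟨σ, G.act σ s (G.act σ t w)⟩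
      have : G.act σ (s * t) w = G.act σ s (G.act σ t w) := by
        apply Subtype.ext
        funext i
        simp [Generators.act, monomial_mul, mul_assoc]
      rw [this]

open Classical in
/-- The coordinates of the distinguished point `x_σ ∈ U_σ ⊆ ℂᵏ`: the `i`-th coordinate is `1` if
`m_i` vanishes on `σ` and `0` otherwise. -/
def distinguishedVec (G : Generators F) (σ : F.cones) : Fin (G.k σ) → ℂ :=
  fun i => if ∀ u ∈ σ.1, ∑ l, (G.m σ i l : ℝ) * u l = 0 then 1 else 0

theorem distinguishedVec_mem (G : Generators F) (σ : F.cones) :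
    distinguishedVec G σ ∈ affineToric (G.m σ) := by
  classical
  obtain ⟨S, hS⟩ := F.rational σ.1 σ.2
  have hmem : ∀ i, ∀ u ∈ S, 0 ≤ ∑ l, G.m σ i l * u l := by
    intro i
    rw [← mem_dualMonoid_hull, ← hS, ← G.closure_eq σ]
    exact AddSubmonoid.subset_closure ⟨i, rfl⟩
  have hsum : ∀ i, ∑ l, G.m σ i l * (∑ u ∈ S, u) l = ∑ u ∈ S, ∑ l, G.m σ i l * u l := by
    intro i
    rw [Finset.sum_comm]
    refine Finset.sum_congr rfl fun l _ => ?_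
    rw [Finset.sum_apply, Finset.mul_sum]
  have hzero : ∀ i, (∀ u ∈ σ.1, ∑ l, (G.m σ i l : ℝ) * u l = 0) ↔
      ∑ l, G.m σ i l * (∑ u ∈ S, u) l = 0 := by
    intro i
    rw [hsum, Finset.sum_eq_zero_iff_of_nonneg (hmem i)]
    constructor
    · intro h u hu
      have h1 := h (latticeVec u)
        (by rw [hS]; exact Submodule.subset_span ⟨u, hu, rfl⟩)
      simp only [latticeVec] at h1
      exact_mod_cast h1
    · intro h x hx
      apply le_antisymm
      · have h2 : -G.m σ i ∈ dualMonoid σ.1 := by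
          rw [hS, mem_dualMonoid_hull]
          intro u hu
          simp [h u hu]
        have := h2 x hx
        simpa using this
      · have h2 : G.m σ i ∈ dualMonoid σ.1 := by
          rw [hS, mem_dualMonoid_hull]
          exact hmem i
        exact h2 x hx
  intro p hp
  let e : Fin (G.k σ) → ℕ := fun i => (∑ l, G.m σ i l * (∑ u ∈ S, u) l).toNat
  have he : ∀ i, (e i : ℤ) = ∑ l, G.m σ i l * (∑ u ∈ S, u) l := by
    intro i
    apply Int.toNat_of_nonneg
    rw [hsum]
    exact Finset.sum_nonneg (hmem i)
  let c : ℂ → Fin (G.k σ) → ℂ := fun z i => z ^ e i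
  have hc : ∀ z : ℂ, z ≠ 0 → MvPolynomial.eval (c z) p = 0 := by
    intro z hz
    apply hp
    refine ⟨fun l => (Units.mk0 z hz) ^ ((∑ u ∈ S, u) l), ?_⟩
    funext i
    have : monomial (G.m σ i) (fun l => (Units.mk0 z hz) ^ ((∑ u ∈ S, u) l)) =
        Units.mk0 z hz ^ e i := by
      rw [← zpow_natCast, he, monomial]
      simp only [← zpow_mul]
      induction (Finset.univ : Finset (Fin n)) using Finset.induction_on with
      | empty => simp
      | insert l s hl ih =>
        rw [Finset.prod_insert hl, Finset.sum_insert hl, zpow_add, ih, mul_comm (G.m σ i l)]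
    simp only [torusMap, this, c, Units.val_pow_eq_pow_val, Units.val_mk0]
  have hcont : Continuous fun z : ℂ => MvPolynomial.eval (c z) p :=
    (MvPolynomial.continuous_eval p).comp
      (continuous_pi fun i => continuous_pow (e i))
  have h0 : MvPolynomial.eval (c 0) p = 0 := by
    have hcl : IsClosed {z : ℂ | MvPolynomial.eval (c z) p = 0} :=
      isClosed_eq hcont continuous_const
    have hsub : ({0}ᶜ : Set ℂ) ⊆ {z : ℂ | MvPolynomial.eval (c z) p = 0} := fun z hz => hc z hz
    have hd : Dense ({0}ᶜ : Set ℂ) := dense_compl_singleton 0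
    exact hcl.closure_subset_iff.2 hsub (hd 0)
  have hc0 : c 0 = distinguishedVec G σ := by
    funext i
    have h1 := he i
    simp only [c, distinguishedVec, hzero i, ← h1]
    by_cases h : e i = 0 <;> simp [h]
  rwa [hc0] at h0

/-- The distinguished point `x_σ`. -/
def distinguished (G : Generators F) (σ : F.cones) : ToricVariety G :=
  mk G σ ⟨distinguishedVec G σ, distinguishedVec_mem G σ⟩

/-- The orbit `orb(σ) = T · x_σ` that corresponds to the cone `σ`. -/
def orb (G : Generators F) (σ : F.cones) : Set (ToricVariety G) :=
  MulAction.orbit (Torus n) (distinguished G σ)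

end ToricVariety

end Variety

/-! ### The bordification -/

/-- The lattice `iℤⁿ` in `ℂⁿ`. -/
def imLattice (n : ℕ) : AddSubgroup (Fin n → ℂ) where
  carrier := {z | ∃ m : Fin n → ℤ, ∀ l, z l = Complex.I * m l}
  zero_mem' := ⟨0, by simp⟩
  add_mem' := by
    rintro a b ⟨m, hm⟩ ⟨k, hk⟩
    exact ⟨m + k, fun l => by simp [hm l, hk l, mul_add]⟩
  neg_mem' := by
    rintro a ⟨m, hm⟩
    exact ⟨-m, fun l => by simp [hm l]⟩

/-- The complex span of `σ` in `ℂⁿ`. -/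
def complexSpan {n : ℕ} (σ : PointedCone ℝ (E n)) : Submodule ℂ (Fin n → ℂ) :=
  Submodule.span ℂ ((fun (x : E n) (l : Fin n) => (x l : ℂ)) '' (σ : Set (E n)))

/-- The boundary component `O(σ) = iℤⁿ \ ℂⁿ / Span_ℂ(σ)`, with its quotient topology. -/
abbrev O {n : ℕ} (σ : PointedCone ℝ (E n)) : Type :=
  (Fin n → ℂ) ⧸ (imLattice n ⊔ (complexSpan σ).toAddSubgroup)

/-- A representative in `ℂⁿ` of `t ∈ T` under the identification `iℤⁿ \ ℂⁿ ≅ T`,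
`z ↦ exp (-2πz)`. -/
def logCoord {n : ℕ} (t : Torus n) : Fin n → ℂ :=
  fun l => -Complex.log (t l : ℂ) / (2 * Real.pi)

/-- The real part `x ∈ ℝⁿ` of a point `x + iy` of `T = iℤⁿ \ ℂⁿ`. -/
def realPart {n : ℕ} (t : Torus n) : E n := WithLp.toLp 2 fun l => (logCoord t l).re

/-- The projection `T = iℤⁿ \ ℂⁿ → O(σ)`. -/
def proj {n : ℕ} (σ : PointedCone ℝ (E n)) (t : Torus n) : O σ :=
  QuotientAddGroup.mk (logCoord t)

theorem exp_logCoord {n : ℕ} (t : Torus n) (l : Fin n) :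
    Complex.exp (-(2 * Real.pi) * logCoord t l) = t l := by
  have h : (-(2 * Real.pi) * logCoord t l : ℂ) = Complex.log (t l : ℂ) := by
    have : (Real.pi : ℂ) ≠ 0 := by exact_mod_cast Real.pi_ne_zero
    simp only [logCoord]
    field_simp
  rw [h, Complex.exp_log (Units.ne_zero _)]

theorem proj_one {n : ℕ} (σ : PointedCone ℝ (E n)) : proj σ 1 = 0 := by
  have : logCoord (1 : Torus n) = 0 := by
    funext l
    simp [logCoord]
  simp [proj, this]

theorem proj_mul {n : ℕ} (σ : PointedCone ℝ (E n)) (s t : Torus n) :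
    proj σ (s * t) = proj σ s + proj σ t := by
  change (QuotientAddGroup.mk (logCoord (s * t)) : O σ) =
    QuotientAddGroup.mk (logCoord s + logCoord t)
  rw [QuotientAddGroup.eq]
  apply (le_sup_left : imLattice n ≤ imLattice n ⊔ (complexSpan σ).toAddSubgroup)
  have hpi : (Real.pi : ℂ) ≠ 0 := by exact_mod_cast Real.pi_ne_zero
  have h : ∀ l, ∃ k : ℤ, -logCoord (s * t) l + (logCoord s l + logCoord t l) = Complex.I * k := by
    intro l
    have h1 : Complex.exp (-(2 * Real.pi) * logCoord (s * t) l) =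
        Complex.exp (-(2 * Real.pi) * (logCoord s l + logCoord t l)) := by
      rw [exp_logCoord, mul_add, Complex.exp_add, exp_logCoord, exp_logCoord]
      simp
    obtain ⟨k, hk⟩ := Complex.exp_eq_exp_iff_exists_int.1 h1
    refine ⟨k, ?_⟩
    have h2 : (2 * Real.pi : ℂ) * (-logCoord (s * t) l + (logCoord s l + logCoord t l)) =
        2 * Real.pi * (Complex.I * k) := by
      linear_combination hk
    exact mul_left_cancel₀ (mul_ne_zero two_ne_zero hpi) h2
  choose k hk using h
  exact ⟨k, hk⟩

/-- Convergence of a sequence `z_j = x_j + iy_j` in `T = iℤⁿ \ ℂⁿ` to a point of `O(σ)`: the real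
part is `x_j = x'_j + x''_j`, where `x'_j` lies in the relative interior of `σ` and its distance to
the relative boundary of `σ` tends to infinity (the distance to the empty set is `⊤`) and `x''_j` is
bounded, and the image of `z_j` in `O(σ)` converges to the point. -/
def ConvergesTo {n : ℕ} (z : ℕ → Torus n) (σ : PointedCone ℝ (E n)) (p : O σ) : Prop :=
  (∃ x' x'' : ℕ → E n,
    (∀ j, realPart (z j) = x' j + x'' j) ∧
    (∀ j, x' j ∈ intrinsicInterior ℝ (σ : Set (E n))) ∧
    Tendsto (fun j => Metric.infEDist (x' j) (intrinsicFrontier ℝ (σ : Set (E n)))) atTop (𝓝 ⊤) ∧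
    ∃ C : ℝ, ∀ j, ‖x'' j‖ ≤ C) ∧
  Tendsto (fun j => proj σ (z j)) atTop (𝓝 p)

/-- The underlying set of the bordification: the disjoint union of the `O(σ)`, `σ ∈ Σ`. The
summand `O({0}) = iℤⁿ \ ℂⁿ` is `T`. -/
def Bordification {n : ℕ} (F : Fan n) : Type := Σ σ : F.cones, O σ.1

namespace Bordification

variable {n : ℕ} (F : Fan n)

/-- The inclusion of the component `O(σ)`. -/
def incl (σ : F.cones) (p : O σ.1) : Bordification F := ⟨σ, p⟩

/-- The inclusion of `T`, by the identification `T = iℤⁿ \ ℂⁿ = O({0})`. -/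
def ofTorus (t : Torus n) : Bordification F := incl F F.zero (proj F.zero.1 t)

/-- All limits of sequences in `A ⊆ T`. -/
def limits (A : Set (Torus n)) : Set (Bordification F) :=
  {b | ∃ z : ℕ → Torus n, (∀ j, z j ∈ A) ∧ ConvergesTo z b.1.1 b.2}

/-- The topology of the bordification: the coarsest one in which, for every `A ⊆ T`, the set of
the limits of all sequences in `A` is closed. -/
instance : TopologicalSpace (Bordification F) :=
  TopologicalSpace.generateFrom {U | ∃ A : Set (Torus n), U = (limits F A)ᶜ}

/-- `T` acts on every component `O(σ)` by translation. -/
instance : MulAction (Torus n) (Bordification F) where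
  smul t b := ⟨b.1, proj b.1.1 t + b.2⟩
  one_smul b := by
    obtain ⟨σ, p⟩ := b
    change (⟨σ, proj σ.1 1 + p⟩ : Σ σ : F.cones, O σ.1) = ⟨σ, p⟩
    rw [proj_one, zero_add]
  mul_smul s t b := by
    obtain ⟨σ, p⟩ := b
    change (⟨σ, proj σ.1 (s * t) + p⟩ : Σ σ : F.cones, O σ.1) =
      ⟨σ, proj σ.1 s + (proj σ.1 t + p)⟩
    rw [proj_mul, add_assoc]

end Bordification

end Toric

end

noncomputable section

namespace Toric


/-! ### Integral functionals and finitely generated cones -/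

/-! Everything is tested by the characters `m ∈ σ^∨ ∩ ℤⁿ`. Such an `m` extends from `T` to `O(σ)`:
it descends to the quotient if `m ∈ σ^⊥` and is extended by zero otherwise (`evalO`). Since `|t^m| =
exp(-2π⟨m, x⟩)`, going deep into `σ` up to a bounded error means that the characters outside `σ^⊥`
tend to zero, while those in `σ^⊥` record the image in `O(σ)`. Hence `σ`-convergence to `p` is the
same as convergence of every `t^m` to `evalO m p` (`convergesTo_iff_monomial`). The converse
direction uses that rational cones and their spans are cut out by lattice points of the dual cone.

A point of the chart `U_σ` is a multiplicative function on `σ^∨ ∩ ℤⁿ`. The characters that do not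
vanish there are those orthogonal to some face `τ`, and on them the function comes from a torus
element. So `U_σ` is the disjoint union of the `O(τ)` with `τ ≤ σ` (`exists_coords_eq`,
`coords_injOn`). These descriptions agree on overlaps and give an equivariant bijection `bordEquiv`
of `X_Σ` with the bordification. As the charts are open in `X_Σ`, a sequence in `T` converges in
`X_Σ` exactly when it is `σ`-convergent to the corresponding point (`tendsto_ofTorus_iff`).

It remains to compare topologies. `T` is dense in `X_Σ`, and `X_Σ` is first countable and locally
compact. It is Hausdorff because limits of sequences in `T` are unique: a functional separating two
cones of the fan cannot be both unbounded and bounded above along one sequence. Thus `X_Σ` is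
regular, and the topology of a regular space is generated by the complements of closures of subsets
of a dense set. By first countability the closure of `A ⊆ T` is its set of sequential limits, so
this is the topology of the bordification. -/

/-- The functional on `ℝⁿ` given by an integral vector. -/
def pairing {n : ℕ} (m : Fin n → ℤ) : E n →ₗ[ℝ] ℝ where
  toFun x := ∑ l, (m l : ℝ) * x l
  map_add' x y := by simp [mul_add, Finset.sum_add_distrib]
  map_smul' a x := by
    simp only [PiLp.smul_apply, smul_eq_mul, RingHom.id_apply, Finset.mul_sum]
    exact Finset.sum_congr rfl fun l _ => by ring

theorem pairing_apply {n : ℕ} (m : Fin n → ℤ) (x : E n) :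
    pairing m x = ∑ l, (m l : ℝ) * x l := rfl

theorem pairing_add {n : ℕ} (m m' : Fin n → ℤ) (x : E n) :
    pairing (m + m') x = pairing m x + pairing m' x := by
  simp [pairing_apply, add_mul, Finset.sum_add_distrib]

theorem pairing_zero {n : ℕ} (x : E n) : pairing 0 x = 0 := by
  simp [pairing_apply]

theorem pairing_neg {n : ℕ} (m : Fin n → ℤ) (x : E n) : pairing (-m) x = -pairing m x := by
  simp [pairing_apply]

theorem pairing_nsmul {n : ℕ} (k : ℕ) (m : Fin n → ℤ) (x : E n) :
    pairing (k • m) x = k * pairing m x := by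
  simp [pairing_apply, Finset.mul_sum, mul_assoc]

theorem mem_dualMonoid {n : ℕ} {σ : PointedCone ℝ (E n)} {m : Fin n → ℤ} :
    m ∈ dualMonoid σ ↔ ∀ u ∈ σ, 0 ≤ pairing m u := Iff.rfl

theorem euclidean_eq_sum {n : ℕ} (x : E n) :
    x = ∑ l, x l • EuclideanSpace.single l (1 : ℝ) := by
  ext i
  simp [Finset.sum_apply, Pi.single_apply]

theorem linearMap_apply_eq_sum {n : ℕ} (f : E n →ₗ[ℝ] ℝ) (x : E n) :
    f x = ∑ l, x l * f (EuclideanSpace.single l 1) := by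
  conv_lhs => rw [euclidean_eq_sum x]
  simp [map_sum]

/-- Farkas' lemma for finitely generated cones. -/
theorem mem_hull_of_forall_dual {ι V : Type*} [AddCommGroup V] [Module ℝ V] (s : Finset ι) :
    ∀ (u : ι → V) (x : V),
      (∀ f : V →ₗ[ℝ] ℝ, (∀ i ∈ s, 0 ≤ f (u i)) → 0 ≤ f x) →
      x ∈ PointedCone.hull ℝ (u '' s) := by
  classical
  induction s using Finset.induction_on with
  | empty =>
    intro u x h
    have : x = 0 := by
      rw [← Module.forall_dual_apply_eq_zero_iff ℝ]
      intro f
      have h1 := h f (by simp)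
      have h2 := h (-f) (by simp)
      simp only [LinearMap.neg_apply] at h2
      linarith
    rw [this]
    exact Submodule.zero_mem _
  | insert j s hj ih =>
    intro u x h
    have hmono : PointedCone.hull ℝ (u '' s) ≤ PointedCone.hull ℝ (u '' ↑(insert j s)) :=
      Submodule.span_mono (Set.image_mono (by simp))
    by_cases hx : ∀ f : V →ₗ[ℝ] ℝ, (∀ i ∈ s, 0 ≤ f (u i)) → 0 ≤ f x
    · exact hmono (ih u x hx)
    push Not at hx
    obtain ⟨f₀, hf₀, hfx⟩ := hx
    have hfj : f₀ (u j) < 0 := by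
      by_contra! hc
      refine absurd (h f₀ fun i hi => ?_) (not_le.2 hfx)
      rcases Finset.mem_insert.1 hi with rfl | hi
      · exact hc
      · exact hf₀ i hi
    set c := -f₀ (u j) with hc
    have hcpos : 0 < c := by linarith
    -- Project along `u j` onto the kernel of `f₀`, and use induction for the projected vectors. A
    -- functional `f` composed with this projection is `f + (f (u j) / c) • f₀`, which vanishes at
    -- `u j`. Undoing the projection of `x` costs `-(f₀ x / c) • u j`, a nonnegative multiple
    -- because `f₀ x < 0`.
    have key := ih (fun i => u i + (f₀ (u i) / c) • u j) (x + (f₀ x / c) • u j) (by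
      intro f hf
      have := h (f + (f (u j) / c) • f₀) (by
        intro i hi
        rcases Finset.mem_insert.1 hi with rfl | hi
        · have : f₀ (u i) = -c := by simp [hc]
          simp only [LinearMap.add_apply, LinearMap.smul_apply, this, smul_eq_mul]
          field_simp
          simp
        · have := hf i hi
          simp only [map_add, map_smul, smul_eq_mul, LinearMap.add_apply,
            LinearMap.smul_apply] at this ⊢
          calc _ ≤ _ := this
            _ = _ := by ring)
      simp only [map_add, map_smul, smul_eq_mul, LinearMap.add_apply,
        LinearMap.smul_apply] at this ⊢
      calc _ ≤ _ := this
        _ = _ := by ring)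
    have hj' : u j ∈ PointedCone.hull ℝ (u '' ↑(insert j s)) :=
      Submodule.subset_span ⟨j, by simp, rfl⟩
    have hle : PointedCone.hull ℝ ((fun i => u i + (f₀ (u i) / c) • u j) '' s) ≤
        PointedCone.hull ℝ (u '' ↑(insert j s)) := by
      refine Submodule.span_le.2 ?_
      rintro _ ⟨i, hi, rfl⟩
      refine Submodule.add_mem _ (hmono (Submodule.subset_span ⟨i, hi, rfl⟩)) ?_
      exact Submodule.smul_mem _ (⟨_, div_nonneg (hf₀ i hi) hcpos.le⟩ : {r : ℝ // 0 ≤ r}) hj'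
    have h1 := hle key
    have h2 : (-(f₀ x / c)) • u j ∈ PointedCone.hull ℝ (u '' ↑(insert j s)) :=
      Submodule.smul_mem _ (⟨_, by
        rw [← neg_div]; exact div_nonneg (by linarith) hcpos.le⟩ : {r : ℝ // 0 ≤ r}) hj'
    have h3 := Submodule.add_mem _ h1 h2
    simpa [add_assoc, ← add_smul] using h3

/-- A real functional can be replaced by an integral one that vanishes on the same integral vectors
of a finite set and is positive on the same vectors of another finite set. -/
theorem exists_pairing_approx {n : ℕ} (f : E n →ₗ[ℝ] ℝ) (S : Set (Fin n → ℤ)) (X : Finset (E n)) :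
    ∃ m : Fin n → ℤ, (∀ u ∈ S, f (latticeVec u) = 0 → pairing m (latticeVec u) = 0) ∧
      ∀ x ∈ X, 0 < f x → 0 < pairing m x := by
  classical
  -- Expand the coefficients of `f` in a `ℚ`-basis `b` of their rational span, then replace `b` by a
  -- nearby rational point `q`. Positivity at finitely many points is an open condition on `q`. A
  -- zero of `f` at an integral vector is a rational relation among the `b i`, hence trivial, and so
  -- it holds for every `q`.
  let a : Fin n → ℝ := fun l => f (EuclideanSpace.single l 1)
  let V : Submodule ℚ ℝ := Submodule.span ℚ (Set.range a)
  have : FiniteDimensional ℚ V := FiniteDimensional.span_of_finite ℚ (Set.finite_range a)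
  let b := Module.finBasis ℚ V
  let c : Fin n → Fin (Module.finrank ℚ V) → ℚ := fun l =>
    b.repr ⟨a l, Submodule.subset_span ⟨l, rfl⟩⟩
  have hc : ∀ l, a l = ∑ i, (c l i : ℝ) * (b i : ℝ) := by
    intro l
    have := congrArg (Subtype.val) (b.sum_repr ⟨a l, Submodule.subset_span ⟨l, rfl⟩⟩)
    simp only [AddSubmonoidClass.coe_finsetSum, SetLike.val_smul] at this
    rw [← this]
    exact Finset.sum_congr rfl fun i _ => by rw [Rat.smul_def]
  let g : (Fin (Module.finrank ℚ V) → ℝ) → E n → ℝ := fun q x => ∑ l, x l * ∑ i, (c l i : ℝ) * q i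
  have hgf : ∀ x, g (fun i => (b i : ℝ)) x = f x := by
    intro x
    rw [linearMap_apply_eq_sum]
    exact Finset.sum_congr rfl fun l _ => by rw [← hc l]
  have hgcont : ∀ x, Continuous fun q => g q x := fun x => by fun_prop
  have hopen : IsOpen {q | ∀ x ∈ X, 0 < f x → 0 < g q x} := by
    have : {q | ∀ x ∈ X, 0 < f x → 0 < g q x} = ⋂ x ∈ X.filter (fun x => 0 < f x),
        {q | 0 < g q x} := by
      ext q; simp
    rw [this]
    exact isOpen_biInter_finset fun x _ => isOpen_lt continuous_const (hgcont x)
  have hdense : DenseRange (fun (q : Fin (Module.finrank ℚ V) → ℚ) i => (q i : ℝ)) :=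
    DenseRange.piMap fun _ => Rat.denseRange_cast
  obtain ⟨q, hq⟩ := hdense.exists_mem_open hopen
    ⟨fun i => (b i : ℝ), fun x _ hx => by rw [hgf]; exact hx⟩
  let r : Fin n → ℚ := fun l => ∑ i, c l i * q i
  have hgr : ∀ x : E n, g (fun i => (q i : ℝ)) x = ∑ l, (r l : ℝ) * x l := by
    intro x
    refine Finset.sum_congr rfl fun l _ => ?_
    simp only [r]
    push_cast
    ring
  let D : ℕ := ∏ l, (r l).den
  have hD : 0 < D := Finset.prod_pos fun l _ => (r l).den_pos
  have hm : ∀ l, ∃ k : ℤ, (k : ℚ) = D * r l := by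
    intro l
    obtain ⟨d, hd⟩ := Finset.dvd_prod_of_mem (fun l => (r l).den) (Finset.mem_univ l)
    refine ⟨d * (r l).num, ?_⟩
    have : (D : ℚ) = (r l).den * d := by exact_mod_cast hd
    rw [this]
    push_cast
    rw [mul_comm _ (d : ℚ), mul_assoc, Rat.den_mul_eq_num]
  choose m hm using hm
  have hpair : ∀ x, pairing m x = D * g (fun i => (q i : ℝ)) x := by
    intro x
    rw [hgr, pairing_apply, Finset.mul_sum]
    refine Finset.sum_congr rfl fun l _ => ?_
    have : (m l : ℝ) = D * r l := by exact_mod_cast hm l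
    rw [this, mul_assoc]
  refine ⟨m, fun u _ hu => ?_, fun x hx hfx => ?_⟩
  · rw [hpair]
    have h0 : ∑ i, (∑ l, (u l : ℚ) * c l i) • (b i) = 0 := by
      apply Subtype.ext
      rw [← hgf] at hu
      simp only [AddSubmonoidClass.coe_finsetSum, SetLike.val_smul, Submodule.coe_zero]
      rw [← hu]
      simp only [g, latticeVec, Rat.smul_def, Finset.mul_sum]
      rw [Finset.sum_comm]
      refine Finset.sum_congr rfl fun i _ => ?_
      push_cast
      rw [Finset.sum_mul]
      exact Finset.sum_congr rfl fun l _ => by ring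
    have h1 := Fintype.linearIndependent_iff.1 b.linearIndependent _ h0
    have : g (fun i => (q i : ℝ)) (latticeVec u) =
        ∑ i, ((∑ l, (u l : ℚ) * c l i : ℚ) : ℝ) * q i := by
      simp only [g, latticeVec, Finset.mul_sum]
      rw [Finset.sum_comm]
      refine Finset.sum_congr rfl fun i _ => ?_
      push_cast
      rw [Finset.sum_mul]
      exact Finset.sum_congr rfl fun l _ => by ring
    rw [this]
    simp [h1]
  · rw [hpair]
    exact mul_pos (by exact_mod_cast hD) (hq x hx hfx)

theorem nonneg_of_mem_hull {V : Type*} [AddCommGroup V] [Module ℝ V] {s : Set V} (f : V →ₗ[ℝ] ℝ)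
    (h : ∀ u ∈ s, 0 ≤ f u) {x : V} (hx : x ∈ PointedCone.hull ℝ s) : 0 ≤ f x := by
  induction hx using Submodule.span_induction with
  | mem x hx => exact h x hx
  | zero => simp
  | add x y _ _ hx hy => rw [map_add]; exact add_nonneg hx hy
  | smul a x _ hx =>
    have : f (a • x) = (a : ℝ) * f x := by
      change f ((a : ℝ) • x) = _
      rw [map_smul, smul_eq_mul]
    rw [this]
    exact mul_nonneg a.2 hx

/-- On a finitely generated cone a functional is bounded by a multiple of a nonnegative one that
has fewer zeros. -/
theorem exists_nat_le_mul {V : Type*} [AddCommGroup V] [Module ℝ V] {s : Set V} (hs : s.Finite)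
    (f g : V →ₗ[ℝ] ℝ) (hf : ∀ u ∈ s, 0 ≤ f u) (hg : ∀ u ∈ s, f u = 0 → g u ≤ 0) :
    ∃ k : ℕ, ∀ x ∈ PointedCone.hull ℝ s, g x ≤ k * f x := by
  classical
  obtain ⟨k, hk⟩ : ∃ k : ℕ, ∀ u ∈ s, g u / f u ≤ k := by
    obtain ⟨C, hC⟩ := (hs.image fun u => g u / f u).bddAbove
    obtain ⟨k, hk⟩ := exists_nat_ge C
    exact ⟨k, fun u hu => (hC ⟨u, hu, rfl⟩).trans hk⟩
  refine ⟨k, fun x hx => ?_⟩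
  have := nonneg_of_mem_hull ((k : ℝ) • f - g) (fun u hu => ?_) hx
  · simp only [LinearMap.sub_apply, LinearMap.smul_apply, smul_eq_mul] at this
    linarith
  · simp only [LinearMap.sub_apply, LinearMap.smul_apply, smul_eq_mul]
    rcases (hf u hu).eq_or_lt with h0 | hpos
    · have := hg u hu h0.symm
      rw [← h0]; linarith
    · have := (div_le_iff₀ hpos).1 (hk u hu)
      linarith

/-- A rational polyhedral cone is cut out by the lattice points of its dual cone. -/
theorem mem_of_forall_dualMonoid {n : ℕ} {σ : PointedCone ℝ (E n)} (hσ : IsRationalPolyhedral σ)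
    {x : E n} (hx : ∀ m ∈ dualMonoid σ, 0 ≤ pairing m x) : x ∈ σ := by
  classical
  obtain ⟨S, rfl⟩ := hσ
  apply mem_hull_of_forall_dual
  intro f hf
  by_contra! hneg
  -- Positivity is kept at the generators, so that `m` lies in the dual cone, and at `-x`, so that
  -- `m` still separates `x` from the cone.
  obtain ⟨m, hm0, hmpos⟩ := exists_pairing_approx f S (insert (-x) (S.image latticeVec))
  have hm : m ∈ dualMonoid (PointedCone.hull ℝ (latticeVec '' (S : Set (Fin n → ℤ)))) := by
    intro u hu
    refine nonneg_of_mem_hull (pairing m) ?_ hu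
    rintro _ ⟨v, hv, rfl⟩
    rcases (hf v hv).eq_or_lt with h0 | hpos
    · exact (hm0 v hv h0.symm).ge
    · exact (hmpos _ (Finset.mem_insert_of_mem (Finset.mem_image_of_mem _ hv)) hpos).le
  have h1 := hmpos (-x) (Finset.mem_insert_self _ _) (by simpa using hneg)
  have h2 := hx m hm
  simp only [map_neg] at h1
  linarith

/-- A face of a rational polyhedral cone is cut out by an integral functional. -/
theorem IsFace.exists_pairing {n : ℕ} {σ τ : PointedCone ℝ (E n)} (hσ : IsRationalPolyhedral σ)
    (h : IsFace τ σ) :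
    ∃ m ∈ dualMonoid σ, ∀ x, x ∈ τ ↔ x ∈ σ ∧ pairing m x = 0 := by
  classical
  obtain ⟨S, rfl⟩ := hσ
  obtain ⟨f, hf, hτ⟩ := h
  obtain ⟨m, hm0, hmpos⟩ := exists_pairing_approx f S (S.image latticeVec)
  have hfS : ∀ u ∈ latticeVec '' (S : Set (Fin n → ℤ)), 0 ≤ f u := fun u hu =>
    hf u (Submodule.subset_span hu)
  have hmS : ∀ u ∈ latticeVec '' (S : Set (Fin n → ℤ)), 0 ≤ pairing m u := by
    rintro _ ⟨v, hv, rfl⟩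
    rcases (hfS _ ⟨v, hv, rfl⟩).eq_or_lt with h0 | hpos
    · exact (hm0 v hv h0.symm).ge
    · exact (hmpos _ (Finset.mem_image_of_mem _ hv) hpos).le
  have hfin : (latticeVec '' (S : Set (Fin n → ℤ))).Finite := S.finite_toSet.image _
  -- The functionals `f` and `m` vanish on the same generators, so on the cone each is bounded by a
  -- multiple of the other and they have the same zeros.
  obtain ⟨k, hk⟩ := exists_nat_le_mul hfin f (pairing m) hfS (by
    rintro _ ⟨v, hv, rfl⟩ h0
    exact (hm0 v hv h0).le)
  obtain ⟨k', hk'⟩ := exists_nat_le_mul hfin (pairing m) f hmS (by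
    rintro _ ⟨v, hv, rfl⟩ h0
    by_contra! hpos
    exact (hmpos _ (Finset.mem_image_of_mem _ hv) hpos).ne' h0)
  refine ⟨m, fun u hu => nonneg_of_mem_hull (pairing m) hmS hu, fun x => ?_⟩
  rw [hτ]
  refine and_congr_right fun hx => ⟨fun h0 => ?_, fun h0 => ?_⟩
  · have := hk x hx
    rw [h0, mul_zero] at this
    exact le_antisymm this (nonneg_of_mem_hull (pairing m) hmS hx)
  · have := hk' x hx
    rw [h0, mul_zero] at this
    exact le_antisymm this (hf x hx)

/-- An integral point of a rational polyhedral cone on which exactly those elements of the dual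
cone vanish that vanish on the whole cone. -/
theorem exists_interior_latticeVec {n : ℕ} {σ : PointedCone ℝ (E n)}
    (hσ : IsRationalPolyhedral σ) :
    ∃ v : Fin n → ℤ, latticeVec v ∈ σ ∧ ∀ f : E n →ₗ[ℝ] ℝ, (∀ x ∈ σ, 0 ≤ f x) →
      f (latticeVec v) = 0 → ∀ x ∈ σ, f x = 0 := by
  classical
  obtain ⟨S, rfl⟩ := hσ
  have hsum : latticeVec (∑ u ∈ S, u) = ∑ u ∈ S, latticeVec u := by
    ext l
    simp [latticeVec, Finset.sum_apply]
  have hmem : ∀ u ∈ S, latticeVec u ∈ PointedCone.hull ℝ (latticeVec '' (S : Set (Fin n → ℤ))) :=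
    fun u hu => Submodule.subset_span ⟨u, hu, rfl⟩
  refine ⟨∑ u ∈ S, u, ?_, fun f hf h0 x hx => ?_⟩
  · rw [hsum]
    exact Submodule.sum_mem _ hmem
  · rw [hsum, map_sum, Finset.sum_eq_zero_iff_of_nonneg fun u hu => hf _ (hmem u hu)] at h0
    apply le_antisymm _ (hf x hx)
    have := nonneg_of_mem_hull (-f) (by rintro _ ⟨u, hu, rfl⟩; simp [h0 u hu]) hx
    simpa using this

/-- The lattice points of `σ^⊥`. -/
def perp {n : ℕ} (σ : PointedCone ℝ (E n)) : Submodule ℤ (Fin n → ℤ) where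
  carrier := {m | ∀ u ∈ σ, pairing m u = 0}
  zero_mem' u _ := pairing_zero u
  add_mem' ha hb u hu := by rw [pairing_add, ha u hu, hb u hu, add_zero]
  smul_mem' c m hm u hu := by
    have : pairing (c • m) u = c * pairing m u := by
      simp [pairing_apply, Finset.mul_sum, mul_assoc]
    rw [this, hm u hu, mul_zero]

theorem perp_anti {n : ℕ} {σ τ : PointedCone ℝ (E n)} (h : τ ≤ σ) : perp σ ≤ perp τ :=
  fun _ hm u hu => hm u (h hu)

theorem dualMonoid_anti {n : ℕ} {σ τ : PointedCone ℝ (E n)} (h : τ ≤ σ) :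
    dualMonoid σ ≤ dualMonoid τ :=
  fun _ hm u hu => hm u (h hu)

theorem mem_dualMonoid_of_mem_perp {n : ℕ} {σ : PointedCone ℝ (E n)} {m : Fin n → ℤ}
    (h : m ∈ perp σ) : m ∈ dualMonoid σ := fun u hu => (h u hu).ge

/-- Two nonnegative numbers with sum zero both vanish. This is what makes the extension of
characters by zero multiplicative. -/
theorem add_mem_perp_iff {n : ℕ} {σ : PointedCone ℝ (E n)} {m m' : Fin n → ℤ}
    (hm : m ∈ dualMonoid σ) (hm' : m' ∈ dualMonoid σ) :
    m + m' ∈ perp σ ↔ m ∈ perp σ ∧ m' ∈ perp σ := by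
  refine ⟨fun h => ⟨fun u hu => ?_, fun u hu => ?_⟩, fun h => (perp σ).add_mem h.1 h.2⟩
  all_goals
    have h1 := h u hu
    have h2 := mem_dualMonoid.1 hm u hu
    have h3 := mem_dualMonoid.1 hm' u hu
    rw [pairing_add] at h1
    linarith

/-- The span of a rational polyhedral cone is cut out by lattice points. -/
theorem mem_span_of_forall_perp {n : ℕ} {σ : PointedCone ℝ (E n)} (hσ : IsRationalPolyhedral σ)
    {x : E n} (hx : ∀ m ∈ perp σ, pairing m x = 0) :
    x ∈ Submodule.span ℝ (σ : Set (E n)) := by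
  classical
  by_contra hc
  obtain ⟨f, hfx, hf⟩ := Submodule.exists_le_ker_of_notMem hc
  have hfσ : ∀ u ∈ σ, f u = 0 := fun u hu => hf (Submodule.subset_span hu)
  obtain ⟨S, rfl⟩ := hσ
  obtain ⟨m, hm0, hmpos⟩ := exists_pairing_approx f S {x, -x}
  have hm0' : ∀ u ∈ S, pairing m (latticeVec u) = 0 := fun u hu =>
    hm0 u hu (hfσ _ (Submodule.subset_span ⟨u, hu, rfl⟩))
  have hm : m ∈ perp (PointedCone.hull ℝ (latticeVec '' (S : Set (Fin n → ℤ)))) := by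
    intro u hu
    apply le_antisymm
    · have := nonneg_of_mem_hull (-pairing m) (by rintro _ ⟨u, hu, rfl⟩; simp [hm0' u hu]) hu
      simpa using this
    · exact nonneg_of_mem_hull (pairing m) (by rintro _ ⟨u, hu, rfl⟩; simp [hm0' u hu]) hu
  have h0 := hx m hm
  rcases lt_or_gt_of_ne hfx with h | h
  · have := hmpos (-x) (by simp) (by simpa using h)
    simp [h0] at this
  · exact (hmpos x (by simp) h).ne' h0

/-- Two cones of a fan are separated by a functional that is positive at a given point of the first
cone outside the second. -/
theorem Fan.exists_separating {n : ℕ} (F : Fan n) {σ τ : PointedCone ℝ (E n)} (hσ : σ ∈ F.cones)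
    (hτ : τ ∈ F.cones) {v : E n} (hv : v ∈ σ) (hvτ : v ∉ τ) :
    ∃ f : E n →ₗ[ℝ] ℝ, (∀ x ∈ σ, 0 ≤ f x) ∧ (∀ x ∈ τ, f x ≤ 0) ∧ 0 < f v := by
  classical
  by_contra! hcon
  obtain ⟨S, hS⟩ := F.rational σ hσ
  obtain ⟨S', hS'⟩ := F.rational τ hτ
  obtain ⟨f, hf, hface⟩ := (F.inter_face σ hσ τ hτ).1
  -- Without a separating functional, Farkas' lemma puts `-v` into `σ - τ`, say `-v = s - t`. Then
  -- `t = s + v` lies in `σ ∩ τ`, where the functional cutting out this face vanishes; being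
  -- nonnegative at `s` and `v`, it vanishes at `v`, so `v ∈ τ`.
  have key := mem_hull_of_forall_dual (S.image latticeVec ∪ S'.image fun u => -latticeVec u) id (-v)
    (by
      intro g hg
      have h1 := hcon g (fun x hx => by
        rw [hS] at hx
        refine nonneg_of_mem_hull g ?_ hx
        rintro _ ⟨u, hu, rfl⟩
        exact hg _ (Finset.mem_union_left _ (Finset.mem_image_of_mem _ hu))) (fun x hx => by
        rw [hS'] at hx
        have := nonneg_of_mem_hull (-g) (fun y hy => by
          obtain ⟨u, hu, rfl⟩ := hy
          have := hg _ (Finset.mem_union_right _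
            (Finset.mem_image_of_mem (fun u => -latticeVec u) hu))
          simpa using this) hx
        simpa using this)
      simpa using h1)
  have hdec : ∀ x ∈ PointedCone.hull ℝ
      (id '' (↑(S.image latticeVec ∪ S'.image fun u => -latticeVec u) : Set (E n))),
      ∃ s ∈ σ, ∃ t ∈ τ, x = s - t := by
    intro x hx
    induction hx using Submodule.span_induction with
    | mem x hx =>
      simp only [id_eq, Set.image_id', Finset.coe_union, Finset.coe_image, Set.mem_union,
        Set.mem_image] at hx
      rcases hx with ⟨u, hu, rfl⟩ | ⟨u, hu, rfl⟩
      · exact ⟨_, by rw [hS]; exact Submodule.subset_span ⟨u, hu, rfl⟩, 0, τ.zero_mem, by simp⟩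
      · exact ⟨0, σ.zero_mem, _, by rw [hS']; exact Submodule.subset_span ⟨u, hu, rfl⟩, by simp⟩
    | zero => exact ⟨0, σ.zero_mem, 0, τ.zero_mem, by simp⟩
    | add x y _ _ hx hy =>
      obtain ⟨s, hs, t, ht, rfl⟩ := hx
      obtain ⟨s', hs', t', ht', rfl⟩ := hy
      exact ⟨s + s', σ.add_mem hs hs', t + t', τ.add_mem ht ht', by abel⟩
    | smul a x _ hx =>
      obtain ⟨s, hs, t, ht, rfl⟩ := hx
      exact ⟨a • s, σ.smul_mem a.2 hs, a • t, τ.smul_mem a.2 ht, smul_sub _ _ _⟩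
  obtain ⟨s, hs, t, ht, hst⟩ := hdec _ key
  have hts : t = s + v := by
    rw [eq_sub_iff_add_eq] at hst
    rw [← hst]; abel
  have h0 : f t = 0 := ((hface t).1 ⟨by rw [hts]; exact σ.add_mem hs hv, ht⟩).2
  rw [hts, map_add] at h0
  have h1 := hf s hs
  have h2 := hf v hv
  exact hvτ ((hface v).2 ⟨hv, by linarith⟩).2


/-! ### Sequences that go to infinity inside a cone -/

/-- The condition on the real parts in the definition of convergence. -/
def TendsInto {n : ℕ} (x : ℕ → E n) (σ : PointedCone ℝ (E n)) : Prop :=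
  ∃ x' x'' : ℕ → E n,
    (∀ j, x j = x' j + x'' j) ∧
    (∀ j, x' j ∈ intrinsicInterior ℝ (σ : Set (E n))) ∧
    Tendsto (fun j => Metric.infEDist (x' j) (intrinsicFrontier ℝ (σ : Set (E n)))) atTop (𝓝 ⊤) ∧
    ∃ C : ℝ, ∀ j, ‖x'' j‖ ≤ C

theorem convergesTo_iff {n : ℕ} {z : ℕ → Torus n} {σ : PointedCone ℝ (E n)} {p : O σ} :
    ConvergesTo z σ p ↔ TendsInto (fun j => realPart (z j)) σ ∧
      Tendsto (fun j => proj σ (z j)) atTop (𝓝 p) := Iff.rfl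

theorem mem_affineSpan_iff_mem_span {n : ℕ} {σ : PointedCone ℝ (E n)} {x : E n} :
    x ∈ affineSpan ℝ (σ : Set (E n)) ↔ x ∈ Submodule.span ℝ (σ : Set (E n)) := by
  have h : (affineSpan ℝ (insert (0 : E n) (σ : Set (E n))) : Set (E n)) =
      Submodule.span ℝ (σ : Set (E n)) := affineSpan_insert_zero _
  rw [Set.insert_eq_of_mem (show (0 : E n) ∈ (σ : Set (E n)) from σ.zero_mem)] at h
  rw [← SetLike.mem_coe, h, SetLike.mem_coe]

/-- The segment from `x` to `x - s • v` stays in the span of `σ`. By connectedness it cannot leave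
`σ` without meeting the relative frontier, at a distance of at most `s * ‖v‖` from `x`. -/
theorem sub_smul_mem_of_lt_infEDist {n : ℕ} {σ : PointedCone ℝ (E n)} {x v : E n} (hx : x ∈ σ)
    (hv : v ∈ σ) {s : ℝ} (hs : 0 ≤ s)
    (hd : ENNReal.ofReal (s * ‖v‖) < Metric.infEDist x (intrinsicFrontier ℝ (σ : Set (E n)))) :
    x - s • v ∈ σ := by
  by_contra hc
  let γ : ℝ → affineSpan ℝ (σ : Set (E n)) := fun r => ⟨x - r • v, by
    rw [mem_affineSpan_iff_mem_span]
    exact Submodule.sub_mem _ (Submodule.subset_span hx)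
      (Submodule.smul_mem _ _ (Submodule.subset_span hv))⟩
  have hγ : Continuous γ := by
    refine Continuous.subtype_mk ?_ _
    fun_prop
  have hpre : IsPreconnected (γ '' Set.Icc 0 s) :=
    isPreconnected_Icc.image _ hγ.continuousOn
  set A : Set (affineSpan ℝ (σ : Set (E n))) := (↑) ⁻¹' (σ : Set (E n)) with hA
  obtain ⟨r, hr, hfr⟩ : ∃ r ∈ Set.Icc 0 s, γ r ∈ frontier A := by
    by_contra! hno
    have h0 : (0 : ℝ) ∈ Set.Icc 0 s := ⟨le_rfl, hs⟩
    have hs' : s ∈ Set.Icc 0 s := ⟨hs, le_rfl⟩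
    have h0A : γ 0 ∈ A := by simpa [γ, hA] using hx
    have hcov : γ '' Set.Icc 0 s ⊆ interior A ∪ (closure A)ᶜ := by
      rintro _ ⟨r, hr, rfl⟩
      by_contra hcon
      simp only [Set.mem_union, Set.mem_compl_iff, not_or, not_not] at hcon
      exact hno r hr ⟨hcon.2, hcon.1⟩
    obtain ⟨q, -, hq1, hq2⟩ := hpre _ _ isOpen_interior isClosed_closure.isOpen_compl hcov
      ⟨γ 0, ⟨0, h0, rfl⟩, (hcov ⟨0, h0, rfl⟩).resolve_right fun h => h (subset_closure h0A)⟩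
      ⟨γ s, ⟨s, hs', rfl⟩, (hcov ⟨s, hs', rfl⟩).resolve_left fun h =>
        hc (show γ s ∈ A from interior_subset h)⟩
    exact hq2 (subset_closure (interior_subset hq1))
  refine absurd (hd.trans_le (Metric.infEDist_le_edist_of_mem
    (mem_intrinsicFrontier.2 ⟨γ r, hfr, rfl⟩))) (not_lt.2 ?_)
  rw [edist_dist]
  apply ENNReal.ofReal_le_ofReal
  simp only [γ, dist_eq_norm, sub_sub_cancel, norm_smul, Real.norm_eq_abs, abs_of_nonneg hr.1]
  exact mul_le_mul_of_nonneg_right hr.2 (norm_nonneg _)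

/-- For each `s ≥ 0` the point `x' j - s • v` is eventually still in `σ`, so `f (x' j) ≥ s * f v`.
The bounded part changes `f` by a bounded amount only. -/
theorem TendsInto.pairing_tendsto {n : ℕ} {σ : PointedCone ℝ (E n)} {x : ℕ → E n}
    (h : TendsInto x σ) (f : E n →ₗ[ℝ] ℝ) (hf : ∀ u ∈ σ, 0 ≤ f u) {v : E n} (hv : v ∈ σ)
    (hfv : 0 < f v) : Tendsto (fun j => f (x j)) atTop atTop := by
  obtain ⟨x', x'', hx, hint, hd, C, hC⟩ := h
  have hmain : Tendsto (fun j => f (x' j)) atTop atTop := by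
    refine tendsto_atTop.2 fun b => ?_
    have hs : 0 ≤ |b| / f v := div_nonneg (abs_nonneg _) hfv.le
    filter_upwards [hd.eventually (lt_mem_nhds
      (ENNReal.ofReal_lt_top (r := |b| / f v * ‖v‖)))] with j hj
    have h1 := hf _ (sub_smul_mem_of_lt_infEDist (intrinsicInterior_subset (hint j)) hv hs hj)
    rw [map_sub, map_smul, smul_eq_mul, div_mul_cancel₀ _ hfv.ne'] at h1
    linarith [le_abs_self b]
  let f' : E n →L[ℝ] ℝ := ⟨f, f.continuous_of_finiteDimensional⟩
  refine tendsto_atTop_mono (fun j => ?_)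
    (tendsto_atTop_add_const_right _ (-(‖f'‖ * C)) hmain)
  have h1 := f'.le_opNorm (x'' j)
  have h2 := mul_le_mul_of_nonneg_left (hC j) (norm_nonneg f')
  have h3 := neg_abs_le (f' (x'' j))
  rw [Real.norm_eq_abs] at h1
  have h5 : f (x j) = f (x' j) + f' (x'' j) := by rw [hx, map_add]; rfl
  linarith

theorem TendsInto.bddBelow {n : ℕ} {σ : PointedCone ℝ (E n)} {x : ℕ → E n}
    (h : TendsInto x σ) (f : E n →ₗ[ℝ] ℝ) (hf : ∀ u ∈ σ, 0 ≤ f u) :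
    ∃ b : ℝ, ∀ j, b ≤ f (x j) := by
  obtain ⟨x', x'', hx, hint, -, C, hC⟩ := h
  let f' : E n →L[ℝ] ℝ := ⟨f, f.continuous_of_finiteDimensional⟩
  refine ⟨-(‖f'‖ * C), fun j => ?_⟩
  have h1 := f'.le_opNorm (x'' j)
  have h2 := mul_le_mul_of_nonneg_left (hC j) (norm_nonneg f')
  have h3 := neg_abs_le (f' (x'' j))
  have h4 := hf _ (intrinsicInterior_subset (hint j))
  rw [Real.norm_eq_abs] at h1
  have h5 : f (x j) = f (x' j) + f' (x'' j) := by rw [hx, map_add]; rfl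
  linarith

/-- For `v ∈ σ` outside `τ`, a functional separating the cones at `v` tends to `+∞` along `x`
because of `σ`, but is bounded above because of `τ`. -/
theorem TendsInto.le {n : ℕ} (F : Fan n) {σ τ : PointedCone ℝ (E n)} (hσ : σ ∈ F.cones)
    (hτ : τ ∈ F.cones) {x : ℕ → E n} (h : TendsInto x σ) (h' : TendsInto x τ) : σ ≤ τ := by
  intro v hv
  by_contra hvτ
  obtain ⟨f, hf, hf', hfv⟩ := F.exists_separating hσ hτ hv hvτ
  obtain ⟨b, hb⟩ := h'.bddBelow (-f) fun u hu => by simpa using hf' u hu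
  obtain ⟨j, hj⟩ := ((h.pairing_tendsto f hf hv hfv).eventually (eventually_gt_atTop (-b))).exists
  have := hb j
  simp only [LinearMap.neg_apply] at this
  linarith

theorem TendsInto.unique {n : ℕ} (F : Fan n) {σ τ : PointedCone ℝ (E n)} (hσ : σ ∈ F.cones)
    (hτ : τ ∈ F.cones) {x : ℕ → E n} (h : TendsInto x σ) (h' : TendsInto x τ) : σ = τ :=
  le_antisymm (h.le F hσ hτ h') (h'.le F hτ hσ h)

/-- A point all of whose neighbours at distance less than `R` in the span lie in the cone. -/
theorem le_infEDist_intrinsicFrontier {n : ℕ} {σ : PointedCone ℝ (E n)} {y : E n}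
    (hy : y ∈ Submodule.span ℝ (σ : Set (E n))) {R : ℝ} (hR : 0 < R)
    (h : ∀ x ∈ Submodule.span ℝ (σ : Set (E n)), dist x y < R → x ∈ σ) :
    y ∈ intrinsicInterior ℝ (σ : Set (E n)) ∧
      ENNReal.ofReal R ≤ Metric.infEDist y (intrinsicFrontier ℝ (σ : Set (E n))) := by
  have hint : ∀ q : affineSpan ℝ (σ : Set (E n)), dist (q : E n) y < R →
      q ∈ interior ((↑) ⁻¹' (σ : Set (E n)) : Set (affineSpan ℝ (σ : Set (E n)))) := by
    intro q hq
    refine mem_interior.2 ⟨{q | dist (q : E n) y < R}, fun x hx => ?_, ?_, hq⟩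
    · exact h x (mem_affineSpan_iff_mem_span.1 x.2) hx
    · exact isOpen_lt (by fun_prop) continuous_const
  refine ⟨mem_intrinsicInterior.2
    ⟨⟨y, mem_affineSpan_iff_mem_span.2 hy⟩, hint _ (by simpa using hR), rfl⟩, ?_⟩
  refine Metric.le_infEDist.2 fun q hq => ?_
  obtain ⟨q, hfr, rfl⟩ := mem_intrinsicFrontier.1 hq
  by_contra! hlt
  rw [edist_comm, edist_dist] at hlt
  exact hfr.2 (hint q ((ENNReal.ofReal_lt_ofReal_iff hR).1 hlt))

/-- Inside its span, `σ` is cut out by the finitely many generators `m` of the dual semigroup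
outside `σ^⊥`. Once each of them is at least `‖m‖ * R` at the orthogonal projection of `x j` to the
span, the ball of radius `R` about this projection, taken in the span, lies in `σ`. -/
theorem tendsInto_of_tendsto {n : ℕ} {σ : PointedCone ℝ (E n)} (hσ : IsRationalPolyhedral σ)
    {x : ℕ → E n}
    (hb : ∃ C, ∀ j, ‖x j - (Submodule.span ℝ (σ : Set (E n))).starProjection (x j)‖ ≤ C)
    (hx : ∀ m ∈ dualMonoid σ, m ∉ perp σ → Tendsto (fun j => pairing m (x j)) atTop atTop) :
    TendsInto x σ := by
  classical
  set K := Submodule.span ℝ (σ : Set (E n)) with hK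
  obtain ⟨C, hC⟩ := hb
  let y : ℕ → E n := fun j => K.starProjection (x j)
  have hyK : ∀ j, y j ∈ K := fun j => K.starProjection_apply_mem _
  obtain ⟨S, hS⟩ := dualMonoid_fg hσ
  let P : (Fin n → ℤ) → E n →L[ℝ] ℝ := fun m =>
    ⟨pairing m, (pairing m).continuous_of_finiteDimensional⟩
  have hperp : ∀ m ∈ perp σ, ∀ u ∈ K, pairing m u = 0 := by
    intro m hm u hu
    have : K ≤ LinearMap.ker (pairing m) := Submodule.span_le.2 fun u hu => hm u hu
    exact this hu
  have hytend : ∀ m ∈ dualMonoid σ, m ∉ perp σ →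
      Tendsto (fun j => pairing m (y j)) atTop atTop := by
    intro m hm hm'
    refine tendsto_atTop_mono (fun j => ?_)
      (tendsto_atTop_add_const_right _ (-(‖P m‖ * C)) (hx m hm hm'))
    have h1 := (P m).le_opNorm (x j - y j)
    have h2 := mul_le_mul_of_nonneg_left (hC j) (norm_nonneg (P m))
    have h3 := le_abs_self (P m (x j - y j))
    rw [Real.norm_eq_abs] at h1
    have h5 : P m (x j - y j) = pairing m (x j) - pairing m (y j) := map_sub (pairing m) _ _
    simp only [y] at *
    linarith
  have hdeep : ∀ R : ℝ, 0 < R → ∀ᶠ j in atTop,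
      y j ∈ intrinsicInterior ℝ (σ : Set (E n)) ∧
      ENNReal.ofReal R ≤ Metric.infEDist (y j) (intrinsicFrontier ℝ (σ : Set (E n))) := by
    intro R hR
    have hev : ∀ᶠ j in atTop, ∀ m ∈ S, m ∉ perp σ → ‖P m‖ * R ≤ pairing m (y j) := by
      refine (eventually_all_finset S).2 fun m hm => ?_
      by_cases hm' : m ∈ perp σ
      · exact Eventually.of_forall fun j h => absurd hm' h
      · have hmS : m ∈ dualMonoid σ := hS ▸ AddSubmonoid.subset_closure hm
        filter_upwards [(hytend m hmS hm').eventually (eventually_ge_atTop (‖P m‖ * R))]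
          with j hj _ using hj
    filter_upwards [hev] with j hj
    refine le_infEDist_intrinsicFrontier (hyK j) hR fun u hu hdist => ?_
    apply mem_of_forall_dualMonoid hσ
    intro m hm
    rw [← hS] at hm
    induction hm using AddSubmonoid.closure_induction with
    | mem m hm =>
      by_cases hm' : m ∈ perp σ
      · exact (hperp m hm' u hu).ge
      · have h1 := (P m).le_opNorm (u - y j)
        rw [← dist_eq_norm, Real.norm_eq_abs] at h1
        have h2 := mul_le_mul_of_nonneg_left hdist.le (norm_nonneg (P m))
        have h3 := neg_abs_le (P m (u - y j))
        have h4 := hj m hm hm'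
        have h5 : P m (u - y j) = pairing m u - pairing m (y j) := map_sub (pairing m) _ _
        linarith
    | zero => rw [pairing_zero]
    | add a b _ _ ha hb => rw [pairing_add]; exact add_nonneg ha hb
  obtain ⟨J, hJ⟩ := eventually_atTop.1 (hdeep 1 one_pos)
  -- The projections lie in the relative interior only from `J` on, whereas the definition asks for
  -- all `j`; the earlier terms are replaced by `y J`, and the sum in the bound below absorbs the
  -- change.
  let x' : ℕ → E n := fun j => if J ≤ j then y j else y J
  have hx'ev : ∀ᶠ j in atTop, x' j = y j := by
    filter_upwards [eventually_ge_atTop J] with j hj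
    simp [x', hj]
  refine ⟨x', fun j => x j - x' j, fun j => by simp, fun j => ?_, ?_, ?_⟩
  · by_cases h : J ≤ j
    · simp only [x', h, if_true]; exact (hJ j h).1
    · simp only [x', h, if_false]; exact (hJ J le_rfl).1
  · refine ENNReal.tendsto_nhds_top fun N => ?_
    filter_upwards [hx'ev, hdeep (N + 1) (by positivity)] with j h1 h2
    rw [h1]
    refine lt_of_lt_of_le ?_ h2.2
    rw [← ENNReal.ofReal_natCast, ENNReal.ofReal_lt_ofReal_iff (by positivity)]
    linarith
  · refine ⟨C + ∑ j ∈ Finset.range J, ‖x j - y J‖, fun j => ?_⟩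
    have hnn : 0 ≤ ∑ j ∈ Finset.range J, ‖x j - y J‖ := Finset.sum_nonneg fun _ _ => norm_nonneg _
    by_cases h : J ≤ j
    · simp only [x', h, if_true]
      have := hC j
      simp only [y]
      linarith
    · simp only [x', h, if_false]
      have h1 := Finset.single_le_sum (f := fun j => ‖x j - y J‖) (fun i _ => norm_nonneg _)
        (Finset.mem_range.2 (not_le.1 h))
      have h2 : 0 ≤ C := (norm_nonneg _).trans (hC 0)
      linarith


/-! ### Monomials and the components of the bordification -/

theorem monomial_zero {n : ℕ} (t : Torus n) : monomial 0 t = 1 := by simp [monomial]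

theorem monomial_add {n : ℕ} (m m' : Fin n → ℤ) (t : Torus n) :
    monomial (m + m') t = monomial m t * monomial m' t := by
  simp [monomial, zpow_add, Finset.prod_mul_distrib]

theorem monomial_sum_zsmul {ι : Type*} {n : ℕ} (s : Finset ι) (a : ι → ℤ) (m : ι → Fin n → ℤ)
    (t : Torus n) : monomial (∑ i ∈ s, a i • m i) t = ∏ i ∈ s, monomial (m i) t ^ a i := by
  classical
  induction s using Finset.induction_on with
  | empty => simp [monomial_zero]
  | insert j s hj ih =>
    rw [Finset.sum_insert hj, Finset.prod_insert hj, monomial_add, ih]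
    congr 1
    simp only [monomial, Pi.smul_apply, smul_eq_mul, ← Finset.prod_zpow, ← zpow_mul]
    exact Finset.prod_congr rfl fun l _ => by rw [mul_comm]

theorem continuous_monomial {n : ℕ} (m : Fin n → ℤ) :
    Continuous (monomial m : Torus n → ℂˣ) := by
  unfold monomial
  fun_prop

theorem monomial_eq_exp {n : ℕ} (m : Fin n → ℤ) {t : Torus n} {z : Fin n → ℂ}
    (h : ∀ l, (t l : ℂ) = Complex.exp (-(2 * Real.pi) * z l)) :
    (monomial m t : ℂ) = Complex.exp (-(2 * Real.pi) * ∑ l, (m l : ℂ) * z l) := by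
  rw [Finset.mul_sum, Complex.exp_sum]
  simp only [monomial, Units.coe_prod, Units.val_zpow_eq_zpow_val, h]
  refine Finset.prod_congr rfl fun l _ => ?_
  rw [← Complex.exp_int_mul]
  congr 1
  ring

/-- The point of the torus given by `z ∈ ℂⁿ`. -/
def expTorus {n : ℕ} (z : Fin n → ℂ) : Torus n :=
  fun l => Units.mk0 (Complex.exp (-(2 * Real.pi) * z l)) (Complex.exp_ne_zero _)

theorem continuous_expTorus {n : ℕ} : Continuous (expTorus : (Fin n → ℂ) → Torus n) := by
  refine continuous_pi fun l => Units.isEmbedding_val₀.continuous_iff.2 ?_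
  change Continuous fun z : Fin n → ℂ => Complex.exp (-(2 * Real.pi) * z l)
  fun_prop

theorem sub_mem_imLattice {n : ℕ} {z w : Fin n → ℂ}
    (h : ∀ l, Complex.exp (-(2 * Real.pi) * z l) = Complex.exp (-(2 * Real.pi) * w l)) :
    z - w ∈ imLattice n := by
  have hpi : (Real.pi : ℂ) ≠ 0 := by exact_mod_cast Real.pi_ne_zero
  have : ∀ l, ∃ k : ℤ, z l - w l = Complex.I * k := by
    intro l
    obtain ⟨k, hk⟩ := Complex.exp_eq_exp_iff_exists_int.1 (h l)
    refine ⟨-k, ?_⟩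
    have h2 : (2 * Real.pi : ℂ) * (z l - w l) = 2 * Real.pi * (Complex.I * (-k : ℤ)) := by
      push_cast
      linear_combination -hk
    exact mul_left_cancel₀ (mul_ne_zero two_ne_zero hpi) h2
  choose k hk using this
  exact ⟨k, hk⟩

theorem proj_expTorus {n : ℕ} (σ : PointedCone ℝ (E n)) (z : Fin n → ℂ) :
    proj σ (expTorus z) = QuotientAddGroup.mk z := by
  refine (QuotientAddGroup.eq.2 ?_)
  apply (le_sup_left : imLattice n ≤ imLattice n ⊔ (complexSpan σ).toAddSubgroup)
  rw [neg_add_eq_sub]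
  refine sub_mem_imLattice fun l => ?_
  rw [exp_logCoord]
  rfl

theorem proj_surjective {n : ℕ} (σ : PointedCone ℝ (E n)) : Function.Surjective (proj σ) := by
  intro p
  obtain ⟨z, rfl⟩ := QuotientAddGroup.mk_surjective p
  exact ⟨expTorus z, proj_expTorus σ z⟩

theorem proj_inv {n : ℕ} (σ : PointedCone ℝ (E n)) (t : Torus n) : proj σ t⁻¹ = -proj σ t := by
  rw [eq_neg_iff_add_eq_zero, ← proj_mul, inv_mul_cancel, proj_one]

/-- The principal branch in `logCoord` is not continuous, but `proj σ` turns products into sums, so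
continuity at `1`, away from the branch cut, is enough. -/
theorem continuous_proj {n : ℕ} (σ : PointedCone ℝ (E n)) : Continuous (proj σ) := by
  rw [continuous_iff_continuousAt]
  intro s
  have h1 : ContinuousAt (proj σ) (1 : Torus n) := by
    refine (ContinuousAt.comp (g := (QuotientAddGroup.mk : (Fin n → ℂ) → O σ)) (f := logCoord)
      QuotientAddGroup.continuous_mk.continuousAt ?_)
    refine continuousAt_pi.2 fun l => ?_
    have hval : Continuous fun t : Torus n => (t l : ℂ) :=
      Units.continuous_val.comp (continuous_apply l)
    exact (hval.continuousAt.clog (by simp)).neg.div_const _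
  have h2 : proj σ = fun t => proj σ s + proj σ (s⁻¹ * t) := by
    funext t
    rw [← proj_mul, mul_inv_cancel_left]
  rw [h2]
  have h3 : ContinuousAt (fun t : Torus n => s⁻¹ * t) s := (continuous_const_mul s⁻¹).continuousAt
  refine continuousAt_const.add (ContinuousAt.comp (g := proj σ) ?_ h3)
  simpa using h1

theorem pairing_realPart {n : ℕ} (m : Fin n → ℤ) (t : Torus n) :
    pairing m (realPart t) = -Real.log ‖(monomial m t : ℂ)‖ / (2 * Real.pi) := by
  rw [monomial_eq_exp m fun l => (exp_logCoord t l).symm, Complex.norm_exp, Real.log_exp]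
  have : (-(2 * Real.pi) * ∑ l, (m l : ℂ) * logCoord t l).re =
      -(2 * Real.pi) * pairing m (realPart t) := by
    have h : (-(2 * Real.pi) * ∑ l, (m l : ℂ) * logCoord t l : ℂ) =
        ((-(2 * Real.pi) : ℝ) : ℂ) * ∑ l, ((m l : ℝ) : ℂ) * logCoord t l := by push_cast; rfl
    rw [h, Complex.re_ofReal_mul, Complex.re_sum]
    simp only [Complex.re_ofReal_mul, pairing_apply, realPart]
  rw [this]
  have := Real.pi_ne_zero
  field_simp

/-! ### Characters orthogonal to a cone, and a section of `T → O(σ)` -/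

/-- The lattice points of `σ^⊥` form a direct summand of `ℤⁿ`. -/
theorem exists_retraction_perp {n : ℕ} (σ : PointedCone ℝ (E n)) :
    ∃ r : (Fin n → ℤ) →ₗ[ℤ] (Fin n → ℤ), (∀ m, r m ∈ perp σ) ∧ ∀ m ∈ perp σ, r m = m := by
  -- If a nonzero multiple of `m` vanishes on `σ`, so does `m`. The quotient is therefore free, and
  -- the quotient map splits.
  have : Module.IsTorsionFree ℤ ((Fin n → ℤ) ⧸ perp σ) := by
    refine Module.IsTorsionFree.of_smul_eq_zero fun c x hcx => ?_
    by_cases hc : c = 0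
    · exact Or.inl hc
    refine Or.inr ?_
    obtain ⟨m, rfl⟩ := Submodule.mkQ_surjective _ x
    rw [← map_smul, Submodule.mkQ_apply, Submodule.Quotient.mk_eq_zero] at hcx
    rw [Submodule.mkQ_apply, Submodule.Quotient.mk_eq_zero]
    intro u hu
    have h1 := hcx u hu
    have h2 : pairing (c • m) u = c * pairing m u := by
      simp [pairing_apply, Finset.mul_sum, mul_assoc]
    rw [h2] at h1
    exact (mul_eq_zero.1 h1).resolve_left (by exact_mod_cast hc)
  have : Module.Free ℤ ((Fin n → ℤ) ⧸ perp σ) := Module.free_of_finite_type_torsion_free'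
  obtain ⟨s, hs⟩ := Module.projective_lifting_property (perp σ).mkQ LinearMap.id
    (Submodule.mkQ_surjective _)
  refine ⟨LinearMap.id - s ∘ₗ (perp σ).mkQ, fun m => ?_, fun m hm => ?_⟩
  · rw [← Submodule.Quotient.mk_eq_zero, ← Submodule.mkQ_apply]
    have := LinearMap.congr_fun hs ((perp σ).mkQ m)
    simp only [LinearMap.comp_apply, LinearMap.id_apply] at this
    simp only [LinearMap.sub_apply, LinearMap.id_apply, LinearMap.comp_apply, map_sub]
    rw [this, sub_self]
  · have : (perp σ).mkQ m = 0 := by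
      rwa [Submodule.mkQ_apply, Submodule.Quotient.mk_eq_zero]
    simp [this]

/-- A chosen retraction of `ℤⁿ` onto the lattice points of `σ^⊥`. -/
def retr {n : ℕ} (σ : PointedCone ℝ (E n)) : (Fin n → ℤ) →ₗ[ℤ] (Fin n → ℤ) :=
  (exists_retraction_perp σ).choose

theorem retr_mem {n : ℕ} (σ : PointedCone ℝ (E n)) (m : Fin n → ℤ) : retr σ m ∈ perp σ :=
  (exists_retraction_perp σ).choose_spec.1 m

theorem retr_eq {n : ℕ} {σ : PointedCone ℝ (E n)} {m : Fin n → ℤ} (h : m ∈ perp σ) :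
    retr σ m = m :=
  (exists_retraction_perp σ).choose_spec.2 m h

/-- The image in `σ^⊥` of the `l`-th basis vector. -/
def retrBasis {n : ℕ} (σ : PointedCone ℝ (E n)) (l : Fin n) : Fin n → ℤ := retr σ (Pi.single l 1)

theorem retrBasis_mem {n : ℕ} (σ : PointedCone ℝ (E n)) (l : Fin n) : retrBasis σ l ∈ perp σ :=
  retr_mem σ _

theorem sum_smul_retrBasis {n : ℕ} {σ : PointedCone ℝ (E n)} {m : Fin n → ℤ} (h : m ∈ perp σ) :
    ∑ l, m l • retrBasis σ l = m := by
  conv_rhs => rw [← retr_eq h, ← Finset.univ_sum_single m, map_sum]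
  refine Finset.sum_congr rfl fun l _ => ?_
  rw [retrBasis, ← map_smul]
  congr 1
  rw [← Pi.single_smul]
  simp

theorem complexSpan_of_mem_span {n : ℕ} {σ : PointedCone ℝ (E n)} {x : E n}
    (hx : x ∈ Submodule.span ℝ (σ : Set (E n))) : (fun l => (x l : ℂ)) ∈ complexSpan σ := by
  induction hx using Submodule.span_induction with
  | mem x hx => exact Submodule.subset_span ⟨x, hx, rfl⟩
  | zero =>
    convert (complexSpan σ).zero_mem using 1
    funext l
    simp
  | add x y _ _ hx hy =>
    convert (complexSpan σ).add_mem hx hy using 1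
    funext l
    simp
  | smul a x _ hx =>
    convert (complexSpan σ).smul_mem (a : ℂ) hx using 1
    funext l
    simp

theorem sum_mul_eq_zero_of_mem_complexSpan {n : ℕ} {σ : PointedCone ℝ (E n)} {m : Fin n → ℤ}
    (hm : m ∈ perp σ) {z : Fin n → ℂ} (hz : z ∈ complexSpan σ) : ∑ l, (m l : ℂ) * z l = 0 := by
  induction hz using Submodule.span_induction with
  | mem x hx =>
    obtain ⟨x, hx, rfl⟩ := hx
    have := hm x hx
    rw [pairing_apply] at this
    simpa using congrArg (fun r : ℝ => (r : ℂ)) this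
  | zero => simp
  | add x y _ _ hx hy => simp [mul_add, Finset.sum_add_distrib, hx, hy]
  | smul a x _ hx =>
    have : ∑ l, (m l : ℂ) * (a • x) l = a * ∑ l, (m l : ℂ) * x l := by
      rw [Finset.mul_sum]
      exact Finset.sum_congr rfl fun l _ => by simp only [Pi.smul_apply, smul_eq_mul]; ring
    rw [this, hx, mul_zero]

theorem monomial_logCoord {n : ℕ} (m : Fin n → ℤ) (t : Torus n) :
    (monomial m t : ℂ) = Complex.exp (-(2 * Real.pi) * ∑ l, (m l : ℂ) * logCoord t l) :=
  monomial_eq_exp m fun l => (exp_logCoord t l).symm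

/-- The points of `O(σ)` are separated by the characters in `σ^⊥`. For the converse, with `z =
logCoord t`, each retracted basis vector takes a value `i k_l` at `z`; since these vectors express
every `m ∈ σ^⊥` with coefficients `m_l`, all of `σ^⊥` annihilates `z - ik`. Its real and imaginary
parts then lie in the span of `σ`. -/
theorem proj_eq_zero_iff {n : ℕ} {σ : PointedCone ℝ (E n)} (hσ : IsRationalPolyhedral σ)
    (t : Torus n) : proj σ t = 0 ↔ ∀ m ∈ perp σ, monomial m t = 1 := by
  have hpi : (Real.pi : ℂ) ≠ 0 := by exact_mod_cast Real.pi_ne_zero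
  constructor
  · intro h m hm
    rw [proj, QuotientAddGroup.eq_zero_iff, AddSubgroup.mem_sup] at h
    obtain ⟨a, ⟨k, hk⟩, b, hb, hab⟩ := h
    apply Units.ext
    rw [monomial_logCoord, ← hab, Units.val_one, Complex.exp_eq_one_iff]
    refine ⟨-∑ l, m l * k l, ?_⟩
    have h0 := sum_mul_eq_zero_of_mem_complexSpan hm (z := b) hb
    simp only [Pi.add_apply, mul_add, Finset.sum_add_distrib, h0, hk]
    push_cast
    rw [mul_zero, add_zero, Finset.mul_sum, ← Finset.sum_neg_distrib, Finset.sum_mul]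
    exact Finset.sum_congr rfl fun l _ => by ring
  · intro h
    have hk : ∀ l, ∃ k : ℤ, ∑ i, (retrBasis σ l i : ℂ) * logCoord t i = Complex.I * k := by
      intro l
      have h1 := congrArg Units.val (h _ (retrBasis_mem σ l))
      rw [monomial_logCoord, Units.val_one, Complex.exp_eq_one_iff] at h1
      obtain ⟨k, hk⟩ := h1
      refine ⟨-k, ?_⟩
      refine mul_left_cancel₀ (mul_ne_zero two_ne_zero hpi) ?_
      push_cast
      linear_combination -hk
    choose k hk using hk
    let w : Fin n → ℂ := fun l => logCoord t l - Complex.I * k l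
    have hw : ∀ m ∈ perp σ, ∑ l, (m l : ℂ) * w l = 0 := by
      intro m hm
      have h1 : ∑ i, (m i : ℂ) * logCoord t i = ∑ l, (m l : ℂ) * (Complex.I * k l) := by
        conv_lhs => rw [← sum_smul_retrBasis hm]
        simp only [← hk, Finset.sum_apply, Pi.smul_apply, smul_eq_mul, Int.cast_sum, Int.cast_mul,
          Finset.mul_sum, Finset.sum_mul]
        rw [Finset.sum_comm]
        exact Finset.sum_congr rfl fun l _ => Finset.sum_congr rfl fun i _ => by ring
      simp only [w, mul_sub, Finset.sum_sub_distrib, h1, sub_self]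
    have hre : (WithLp.toLp 2 fun l => (w l).re : E n) ∈ Submodule.span ℝ (σ : Set (E n)) := by
      refine mem_span_of_forall_perp hσ fun m hm => ?_
      have := congrArg Complex.re (hw m hm)
      simpa [Complex.re_sum, pairing_apply] using this
    have him : (WithLp.toLp 2 fun l => (w l).im : E n) ∈ Submodule.span ℝ (σ : Set (E n)) := by
      refine mem_span_of_forall_perp hσ fun m hm => ?_
      have := congrArg Complex.im (hw m hm)
      simpa [Complex.im_sum, pairing_apply] using this
    have hwmem : w ∈ complexSpan σ := by
      convert (complexSpan σ).add_mem (complexSpan_of_mem_span hre)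
        ((complexSpan σ).smul_mem Complex.I (complexSpan_of_mem_span him)) using 1
      funext l
      simp only [Pi.add_apply, Pi.smul_apply, smul_eq_mul]
      rw [mul_comm, Complex.re_add_im]
    rw [proj, QuotientAddGroup.eq_zero_iff, AddSubgroup.mem_sup]
    refine ⟨fun l => Complex.I * k l, ⟨k, fun l => rfl⟩, w, hwmem, ?_⟩
    funext l
    simp [w]

theorem monomial_inv {n : ℕ} (m : Fin n → ℤ) (t : Torus n) :
    monomial m t⁻¹ = (monomial m t)⁻¹ := by
  simp [monomial]

theorem proj_eq_iff {n : ℕ} {σ : PointedCone ℝ (E n)} (hσ : IsRationalPolyhedral σ)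
    {s t : Torus n} : proj σ s = proj σ t ↔ ∀ m ∈ perp σ, monomial m s = monomial m t := by
  rw [← sub_eq_zero, sub_eq_add_neg, ← proj_inv, ← proj_mul, proj_eq_zero_iff hσ]
  simp only [monomial_mul, monomial_inv, mul_inv_eq_one]

/-- A representative in the torus of a point of `O(σ)`. -/
def rep {n : ℕ} {σ : PointedCone ℝ (E n)} (p : O σ) : Torus n := (proj_surjective σ p).choose

theorem proj_rep {n : ℕ} {σ : PointedCone ℝ (E n)} (p : O σ) : proj σ (rep p) = p :=
  (proj_surjective σ p).choose_spec

/-- The value on `O(σ)` of the character `m`; it is meaningful for `m ∈ σ^⊥`. -/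
def char {n : ℕ} {σ : PointedCone ℝ (E n)} (m : Fin n → ℤ) (p : O σ) : ℂˣ := monomial m (rep p)

theorem char_proj {n : ℕ} {σ : PointedCone ℝ (E n)} (hσ : IsRationalPolyhedral σ)
    {m : Fin n → ℤ} (hm : m ∈ perp σ) (t : Torus n) : char m (proj σ t) = monomial m t :=
  (proj_eq_iff hσ).1 (proj_rep (proj σ t)) m hm

theorem continuous_char {n : ℕ} {σ : PointedCone ℝ (E n)} (hσ : IsRationalPolyhedral σ)
    {m : Fin n → ℤ} (hm : m ∈ perp σ) : Continuous (char m : O σ → ℂˣ) := by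
  rw [(QuotientAddGroup.isQuotientMap_mk _).continuous_iff]
  have : (char m : O σ → ℂˣ) ∘ QuotientAddGroup.mk = fun z => monomial m (expTorus z) := by
    funext z
    rw [Function.comp_apply, ← proj_expTorus, char_proj hσ hm]
  rw [this]
  exact (continuous_monomial m).comp continuous_expTorus

/-- A section of the projection `T → O(σ)`. -/
def sec {n : ℕ} {σ : PointedCone ℝ (E n)} (p : O σ) : Torus n := fun l => char (retrBasis σ l) p

theorem continuous_sec {n : ℕ} {σ : PointedCone ℝ (E n)} (hσ : IsRationalPolyhedral σ) :
    Continuous (sec : O σ → Torus n) :=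
  continuous_pi fun _ => continuous_char hσ (retrBasis_mem σ _)

/-- The torus element with coordinates the monomials `retrBasis σ l` has the same image in
`O(σ)`. -/
theorem proj_monomial_retrBasis {n : ℕ} {σ : PointedCone ℝ (E n)} (hσ : IsRationalPolyhedral σ)
    (t : Torus n) : proj σ (fun l => monomial (retrBasis σ l) t) = proj σ t := by
  refine (proj_eq_iff hσ).2 fun m hm => ?_
  conv_rhs => rw [← sum_smul_retrBasis hm, monomial_sum_zsmul]
  rfl

theorem proj_sec {n : ℕ} {σ : PointedCone ℝ (E n)} (hσ : IsRationalPolyhedral σ) (p : O σ) :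
    proj σ (sec p) = p := by
  conv_rhs => rw [← proj_rep p]
  exact proj_monomial_retrBasis hσ (rep p)

theorem sec_proj {n : ℕ} {σ : PointedCone ℝ (E n)} (hσ : IsRationalPolyhedral σ) (t : Torus n)
    (l : Fin n) : sec (proj σ t) l = monomial (retrBasis σ l) t :=
  char_proj hσ (retrBasis_mem σ _) t

/-- The section `sec` embeds `O(σ)` continuously and injectively into the Hausdorff torus. -/
theorem O.t2Space {n : ℕ} {σ : PointedCone ℝ (E n)} (hσ : IsRationalPolyhedral σ) :
    T2Space (O σ) :=
  T2Space.of_injective_continuous (Function.LeftInverse.injective (proj_sec hσ))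
    (continuous_sec hσ)

theorem continuous_realPart {n : ℕ} : Continuous (realPart : Torus n → E n) := by
  refine (PiLp.continuous_toLp 2 _).comp (continuous_pi fun l => ?_)
  have : (fun t : Torus n => (logCoord t l).re) =
      fun t => -Real.log ‖(t l : ℂ)‖ / (2 * Real.pi) := by
    funext t
    have : logCoord t l = (-Complex.log (t l : ℂ)) / ((2 * Real.pi : ℝ) : ℂ) := by
      simp [logCoord]
    rw [this, Complex.div_ofReal_re, Complex.neg_re, Complex.log_re]
  rw [this]
  refine Continuous.div_const (Continuous.neg (Continuous.log ?_ fun t => ?_)) _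
  · exact (Units.continuous_val.comp (continuous_apply l)).norm
  · exact norm_ne_zero_iff.2 (Units.ne_zero _)

/-- The character `m ∈ σ^∨` on the partial compactification of the torus by `O(σ)`: it is zero
on `O(σ)` unless `m ∈ σ^⊥`. -/
def evalO {n : ℕ} {σ : PointedCone ℝ (E n)} (m : Fin n → ℤ) (p : O σ) : ℂ :=
  open Classical in if m ∈ perp σ then (char m p : ℂ) else 0

theorem evalO_of_mem {n : ℕ} {σ : PointedCone ℝ (E n)} {m : Fin n → ℤ} (h : m ∈ perp σ)
    (p : O σ) : evalO m p = char m p := if_pos h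

theorem evalO_of_notMem {n : ℕ} {σ : PointedCone ℝ (E n)} {m : Fin n → ℤ} (h : m ∉ perp σ)
    (p : O σ) : evalO m p = 0 := if_neg h

theorem exists_pos_of_notMem_perp {n : ℕ} {σ : PointedCone ℝ (E n)} {m : Fin n → ℤ}
    (h : m ∈ dualMonoid σ) (h' : m ∉ perp σ) : ∃ v ∈ σ, 0 < pairing m v := by
  by_contra! hc
  exact h' fun u hu => le_antisymm (hc u hu) (h u hu)

/-- Convergence to a point of `O(σ)` in terms of monomials. -/
theorem convergesTo_iff_monomial {n : ℕ} {σ : PointedCone ℝ (E n)} (hσ : IsRationalPolyhedral σ)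
    {z : ℕ → Torus n} {p : O σ} :
    ConvergesTo z σ p ↔ ∀ m ∈ dualMonoid σ,
      Tendsto (fun j => (monomial m (z j) : ℂ)) atTop (𝓝 (evalO m p)) := by
  have h2pi : 0 < 2 * Real.pi := by positivity
  have hnorm : ∀ m j, ‖(monomial m (z j) : ℂ)‖ =
      Real.exp (-(2 * Real.pi * pairing m (realPart (z j)))) := by
    intro m j
    rw [pairing_realPart, mul_div_cancel₀ _ h2pi.ne', neg_neg, Real.exp_log]
    exact norm_pos_iff.2 (Units.ne_zero _)
  rw [convergesTo_iff]
  constructor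
  · rintro ⟨h1, h2⟩ m hm
    by_cases hm' : m ∈ perp σ
    · rw [evalO_of_mem hm']
      have := (Units.continuous_val.comp (continuous_char hσ hm')).tendsto p |>.comp h2
      simpa only [Function.comp_def, char_proj hσ hm'] using this
    · rw [evalO_of_notMem hm', tendsto_zero_iff_norm_tendsto_zero]
      obtain ⟨v, hv, hmv⟩ := exists_pos_of_notMem_perp hm hm'
      have := h1.pairing_tendsto (pairing m) hm hv hmv
      simp only [hnorm]
      exact Real.tendsto_exp_neg_atTop_nhds_zero.comp (this.const_mul_atTop h2pi)
  · intro h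
    -- The coordinates of the section are monomials with exponents in `σ^⊥ ⊆ σ^∨`, so they converge
    -- by hypothesis.
    have hsec : Tendsto (fun j => sec (proj σ (z j))) atTop (𝓝 (sec p)) := by
      refine tendsto_pi_nhds.2 fun l => Units.isEmbedding_val₀.tendsto_nhds_iff.2 ?_
      have h1 := h _ (mem_dualMonoid_of_mem_perp (retrBasis_mem σ l))
      rw [evalO_of_mem (retrBasis_mem σ _)] at h1
      simp only [Function.comp_def, sec_proj hσ]
      exact h1
    have hproj : Tendsto (fun j => proj σ (z j)) atTop (𝓝 p) := by
      have := ((continuous_proj σ).tendsto (sec p)).comp hsec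
      simpa only [Function.comp_def, proj_sec hσ] using this
    refine ⟨tendsInto_of_tendsto hσ ?_ fun m hm hm' => ?_, hproj⟩
    · set K := Submodule.span ℝ (σ : Set (E n))
      -- The component of the real part orthogonal to the span depends only on the image in `O(σ)`.
      -- It can be computed on the convergent sequence of section values, and is therefore bounded.
      have hdiff : ∀ j, realPart (z j) - K.starProjection (realPart (z j)) =
          realPart (sec (proj σ (z j))) - K.starProjection (realPart (sec (proj σ (z j)))) := by
        intro j
        have hK : realPart (z j) - realPart (sec (proj σ (z j))) ∈ K := by
          refine mem_span_of_forall_perp hσ fun m hm => ?_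
          rw [map_sub, pairing_realPart, pairing_realPart,
            (proj_eq_iff hσ).1 (proj_sec hσ (proj σ (z j))) m hm, sub_self]
        have := Submodule.starProjection_eq_self_iff.2 hK
        rw [map_sub] at this
        rw [sub_eq_sub_iff_sub_eq_sub, this]
      have hcont : Continuous fun t : Torus n => ‖realPart t - K.starProjection (realPart t)‖ :=
        (continuous_realPart.sub (K.starProjection.continuous.comp continuous_realPart)).norm
      have hlim := (hcont.tendsto _).comp hsec
      obtain ⟨C, hC⟩ := hlim.bddAbove_range
      refine ⟨C, fun j => ?_⟩
      rw [hdiff]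
      exact hC ⟨j, rfl⟩
    · have h1 := (tendsto_zero_iff_norm_tendsto_zero.1 (evalO_of_notMem hm' p ▸ h m hm))
      have h2 : Tendsto (fun j => ‖(monomial m (z j) : ℂ)‖) atTop (𝓝[>] 0) :=
        tendsto_nhdsWithin_iff.2 ⟨h1, Eventually.of_forall fun j =>
          norm_pos_iff.2 (Units.ne_zero _)⟩
      have h3 := (tendsto_neg_atBot_atTop.comp
        (Real.tendsto_log_nhdsGT_zero.comp h2)).atTop_div_const h2pi
      simpa only [Function.comp_def, pairing_realPart] using h3


/-! ### The charts as sets of points of the bordification -/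

section Eval

variable {n : ℕ} {σ : PointedCone ℝ (E n)}

theorem evalO_zero (p : O σ) : evalO 0 p = 1 := by
  rw [evalO_of_mem (Submodule.zero_mem _)]
  simp [char, monomial_zero]

theorem evalO_add {m m' : Fin n → ℤ} (hm : m ∈ dualMonoid σ) (hm' : m' ∈ dualMonoid σ)
    (p : O σ) : evalO (m + m') p = evalO m p * evalO m' p := by
  by_cases h : m + m' ∈ perp σ
  · obtain ⟨h1, h2⟩ := (add_mem_perp_iff hm hm').1 h
    rw [evalO_of_mem h, evalO_of_mem h1, evalO_of_mem h2, char, monomial_add]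
    simp [char]
  · rw [evalO_of_notMem h]
    by_cases h1 : m ∈ perp σ
    · have h2 : m' ∉ perp σ := fun h2 => h ((perp σ).add_mem h1 h2)
      rw [evalO_of_notMem h2, mul_zero]
    · rw [evalO_of_notMem h1, zero_mul]

theorem evalO_nsmul {m : Fin n → ℤ} (hm : m ∈ dualMonoid σ) (k : ℕ) (p : O σ) :
    evalO (k • m) p = evalO m p ^ k := by
  induction k with
  | zero => simp [evalO_zero]
  | succ k ih =>
    rw [add_smul, one_smul, evalO_add ((dualMonoid σ).nsmul_mem hm k) hm, ih, pow_succ]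

theorem evalO_sum_nsmul {ι : Type*} (s : Finset ι) (a : ι → ℕ) {m : ι → Fin n → ℤ}
    (hm : ∀ i, m i ∈ dualMonoid σ) (p : O σ) :
    evalO (∑ i ∈ s, a i • m i) p = ∏ i ∈ s, evalO (m i) p ^ a i := by
  classical
  induction s using Finset.induction_on with
  | empty => simp [evalO_zero]
  | insert j s hj ih =>
    rw [Finset.sum_insert hj, Finset.prod_insert hj, evalO_add, ih, evalO_nsmul (hm j)]
    · exact (dualMonoid σ).nsmul_mem (hm j) _
    · exact (dualMonoid σ).sum_mem fun i _ => (dualMonoid σ).nsmul_mem (hm i) _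

theorem evalO_ne_zero_iff {m : Fin n → ℤ} {p : O σ} : evalO m p ≠ 0 ↔ m ∈ perp σ := by
  by_cases h : m ∈ perp σ
  · simp [evalO_of_mem h, h]
  · simp [evalO_of_notMem h, h]

theorem evalO_proj_add (hσ : IsRationalPolyhedral σ) (m : Fin n → ℤ) (t : Torus n) (p : O σ) :
    evalO m (proj σ t + p) = monomial m t * evalO m p := by
  by_cases h : m ∈ perp σ
  · rw [evalO_of_mem h, evalO_of_mem h]
    obtain ⟨s, rfl⟩ := proj_surjective σ p
    rw [← proj_mul, char_proj hσ h, char_proj hσ h, monomial_mul, Units.val_mul]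
  · rw [evalO_of_notMem h, evalO_of_notMem h, mul_zero]

/-- Points of `O(σ)` are determined by the characters in `σ^⊥`. -/
theorem O.ext_char (hσ : IsRationalPolyhedral σ) {p q : O σ}
    (h : ∀ m ∈ perp σ, char m p = char m q) : p = q := by
  rw [← proj_rep p, ← proj_rep q]
  exact (proj_eq_iff hσ).2 h

/-- Every point of `O(σ)` is the limit of a sequence in the torus. -/
theorem exists_convergesTo (hσ : IsRationalPolyhedral σ) (p : O σ) :
    ∃ z : ℕ → Torus n, ConvergesTo z σ p := by
  obtain ⟨v, hv, hv0⟩ := exists_interior_latticeVec hσ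
  -- Move from a representative of `p` along the ray of the interior lattice point `v`: characters
  -- in `σ^⊥` stay constant, and the others in `σ^∨` decay geometrically.
  let z : ℕ → Torus n := fun j => rep p * expTorus fun l => ((j * v l : ℝ) : ℂ)
  refine ⟨z, (convergesTo_iff_monomial hσ).2 fun m hm => ?_⟩
  have hz : ∀ j, (monomial m (z j) : ℂ) = monomial m (rep p) *
      (Real.exp (-(2 * Real.pi * pairing m (latticeVec v))) : ℂ) ^ j := by
    intro j
    rw [monomial_mul, Units.val_mul, monomial_eq_exp m
      (t := expTorus fun l => ((j * v l : ℝ) : ℂ)) (z := fun l => ((j * v l : ℝ) : ℂ))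
      fun l => rfl, ← Complex.ofReal_pow, ← Real.exp_nat_mul, Complex.ofReal_exp]
    congr 2
    simp only [pairing_apply, latticeVec]
    push_cast
    simp only [Finset.mul_sum, ← Finset.sum_neg_distrib]
    exact Finset.sum_congr rfl fun l _ => by ring
  simp only [hz]
  by_cases h : m ∈ perp σ
  · rw [evalO_of_mem h, char, h _ hv]
    simp
  · rw [evalO_of_notMem h, ← mul_zero (monomial m (rep p) : ℂ)]
    refine Tendsto.const_mul _ (tendsto_pow_atTop_nhds_zero_of_norm_lt_one ?_)
    have hpos : 0 < pairing m (latticeVec v) := by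
      refine lt_of_le_of_ne (hm _ hv) fun h0 => h ?_
      exact hv0 (pairing m) hm h0.symm
    rw [Complex.norm_real, Real.norm_eq_abs, Real.abs_exp, Real.exp_lt_one_iff]
    have : 0 < 2 * Real.pi * pairing m (latticeVec v) := by positivity
    linarith

end Eval

theorem IsFace.le {n : ℕ} {σ τ : PointedCone ℝ (E n)} (h : IsFace τ σ) : τ ≤ σ := by
  obtain ⟨f, -, h⟩ := h
  exact fun x hx => ((h x).1 hx).1

theorem Fan.isFace {n : ℕ} (F : Fan n) {σ τ : PointedCone ℝ (E n)} (hσ : σ ∈ F.cones)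
    (hτ : τ ∈ F.cones) (h : τ ≤ σ) : IsFace τ σ := by
  have := (F.inter_face σ hσ τ hτ).1
  rwa [inf_eq_right.2 h] at this

/-- For a face `τ` of `σ` cut out by `M`, the semigroup of `τ` is generated by that of `σ`
and `-M`. -/
theorem exists_add_nsmul_mem {n : ℕ} {σ τ : PointedCone ℝ (E n)} (hσ : IsRationalPolyhedral σ)
    {M m : Fin n → ℤ} (hM : M ∈ dualMonoid σ) (hτ : ∀ x, x ∈ τ ↔ x ∈ σ ∧ pairing M x = 0)
    (hm : m ∈ dualMonoid τ) : ∃ k : ℕ, m + k • M ∈ dualMonoid σ := by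
  obtain ⟨S, hS⟩ := hσ
  have hmem : ∀ u ∈ latticeVec '' (S : Set (Fin n → ℤ)), u ∈ σ := fun u hu => by
    rw [hS]; exact Submodule.subset_span hu
  -- Generators of `σ` at which `M` vanishes lie in `τ`, where `-m ≤ 0`; so `-m ≤ k M` on all of `σ`
  -- for some `k`.
  obtain ⟨k, hk⟩ := exists_nat_le_mul (S.finite_toSet.image latticeVec) (pairing M) (-pairing m)
    (fun u hu => hM u (hmem u hu)) (fun u hu h0 => by
      have h1 : 0 ≤ pairing m u := hm u ((hτ u).2 ⟨hmem u hu, h0⟩)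
      simpa using h1)
  refine ⟨k, fun x hx => ?_⟩
  rw [hS] at hx
  have := hk x hx
  change 0 ≤ pairing (m + k • M) x
  rw [pairing_add, pairing_nsmul]
  simp only [LinearMap.neg_apply] at this
  linarith

section Charts

variable {n : ℕ} {F : Fan n} (G : Generators F)

theorem Generators.mem (σ : F.cones) (i : Fin (G.k σ)) : G.m σ i ∈ dualMonoid σ.1 := by
  rw [← G.closure_eq σ]
  exact AddSubmonoid.subset_closure ⟨i, rfl⟩

theorem Generators.exists_eq_sum (σ : F.cones) {m : Fin n → ℤ} (hm : m ∈ dualMonoid σ.1) :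
    ∃ a : Fin (G.k σ) → ℕ, m = ∑ i, a i • G.m σ i := by
  rw [← G.closure_eq σ] at hm
  induction hm using AddSubmonoid.closure_induction with
  | mem x hx =>
    obtain ⟨i, rfl⟩ := hx
    exact ⟨Pi.single i 1, by simp [Pi.single_apply]⟩
  | zero => exact ⟨0, by simp⟩
  | add x y _ _ hx hy =>
    obtain ⟨a, rfl⟩ := hx
    obtain ⟨b, rfl⟩ := hy
    exact ⟨a + b, by simp [add_smul, Finset.sum_add_distrib]⟩

/-- The coordinates in the chart of `σ` of a point of the bordification. -/
def coords (σ : F.cones) (b : Bordification F) : Fin (G.k σ) → ℂ :=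
  fun i => evalO (G.m σ i) b.2

/-- The point `b` is a limit of torus points, and a polynomial vanishing on the image of the torus
vanishes at the limit by continuity. -/
theorem coords_mem {σ : F.cones} {b : Bordification F} (h : b.1.1 ≤ σ.1) :
    coords G σ b ∈ affineToric (G.m σ) := by
  obtain ⟨τ, p⟩ := b
  intro f hf
  obtain ⟨z, hz⟩ := exists_convergesTo (F.rational τ.1 τ.2) p
  have hz' := (convergesTo_iff_monomial (F.rational τ.1 τ.2)).1 hz
  have hlim : Tendsto (fun j => torusMap (G.m σ) (z j)) atTop (𝓝 (coords G σ ⟨τ, p⟩)) :=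
    tendsto_pi_nhds.2 fun i => hz' _ (dualMonoid_anti h (G.mem σ i))
  have h1 := ((MvPolynomial.continuous_eval f).tendsto _).comp hlim
  refine tendsto_nhds_unique h1 ?_
  have : (fun w => MvPolynomial.eval w f) ∘ (fun j => torusMap (G.m σ) (z j)) = fun _ => 0 := by
    funext j
    exact hf _ ⟨z j, rfl⟩
  rw [this]
  exact tendsto_const_nhds

/-- The value of the character `m = ∑ aᵢ mᵢ` at a point of `ℂᵏ`. -/
def charVal {n k : ℕ} (m : Fin k → Fin n → ℤ) (w : Fin k → ℂ) (x : Fin n → ℤ) : ℂ :=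
  open Classical in
  if h : ∃ a : Fin k → ℕ, x = ∑ i, a i • m i then ∏ i, w i ^ h.choose i else 0

/-- Two ways of writing `x` through the generators give a binomial that vanishes on the image of the
torus, hence on its Zariski closure. So the choice in `charVal` does not matter. -/
theorem charVal_eq {n k : ℕ} {m : Fin k → Fin n → ℤ} {w : Fin k → ℂ} (hw : w ∈ affineToric m)
    {x : Fin n → ℤ} {a : Fin k → ℕ} (hx : x = ∑ i, a i • m i) :
    charVal m w x = ∏ i, w i ^ a i := by
  have h : ∃ a : Fin k → ℕ, x = ∑ i, a i • m i := ⟨a, hx⟩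
  rw [charVal, dif_pos h]
  set b := h.choose with hb
  have hxb : x = ∑ i, b i • m i := h.choose_spec
  have := hw (∏ i, MvPolynomial.X i ^ b i - ∏ i, MvPolynomial.X i ^ a i) (by
    rintro _ ⟨t, rfl⟩
    have h1 : monomial (∑ i, b i • m i) t = monomial (∑ i, a i • m i) t := by rw [← hxb, ← hx]
    rw [monomial_sum, monomial_sum] at h1
    have h2 := congrArg Units.val h1
    simp only [Units.coe_prod, Units.val_pow_eq_pow_val] at h2
    simp only [map_sub, map_prod, map_pow, MvPolynomial.eval_X, torusMap, h2, sub_self])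
  simpa only [map_sub, map_prod, map_pow, MvPolynomial.eval_X, sub_eq_zero] using this

variable {G} in
theorem charVal_gen {σ : F.cones} {w : Fin (G.k σ) → ℂ} (hw : w ∈ affineToric (G.m σ))
    (i : Fin (G.k σ)) : charVal (G.m σ) w (G.m σ i) = w i := by
  rw [charVal_eq hw (a := Pi.single i 1) (by simp [Pi.single_apply])]
  simp [Pi.single_apply]

variable {G} in
theorem charVal_add {σ : F.cones} {w : Fin (G.k σ) → ℂ} (hw : w ∈ affineToric (G.m σ))
    {x y : Fin n → ℤ} (hx : x ∈ dualMonoid σ.1) (hy : y ∈ dualMonoid σ.1) :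
    charVal (G.m σ) w (x + y) = charVal (G.m σ) w x * charVal (G.m σ) w y := by
  obtain ⟨a, ha⟩ := G.exists_eq_sum σ hx
  obtain ⟨b, hb⟩ := G.exists_eq_sum σ hy
  rw [charVal_eq hw ha, charVal_eq hw hb, charVal_eq hw (a := a + b)
    (by rw [ha, hb]; simp [add_smul, Finset.sum_add_distrib]), ← Finset.prod_mul_distrib]
  exact Finset.prod_congr rfl fun i _ => pow_add _ _ _

variable {G} in
theorem charVal_nsmul {σ : F.cones} {w : Fin (G.k σ) → ℂ} (hw : w ∈ affineToric (G.m σ))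
    {x : Fin n → ℤ} (hx : x ∈ dualMonoid σ.1) (k : ℕ) :
    charVal (G.m σ) w (k • x) = charVal (G.m σ) w x ^ k := by
  induction k with
  | zero => rw [zero_smul, charVal_eq hw (a := 0) (by simp)]; simp
  | succ k ih =>
    rw [add_smul, one_smul, charVal_add hw ((dualMonoid σ.1).nsmul_mem hx k) hx, ih, pow_succ]

/-- The face of `σ` cut out by `M ∈ σ^∨`. -/
def faceOf {n : ℕ} (σ : PointedCone ℝ (E n)) (M : Fin n → ℤ) : PointedCone ℝ (E n) where
  carrier := {x | x ∈ σ ∧ pairing M x = 0}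
  zero_mem' := ⟨σ.zero_mem, map_zero _⟩
  add_mem' := fun ha hb => ⟨σ.add_mem ha.1 hb.1, by rw [map_add, ha.2, hb.2, add_zero]⟩
  smul_mem' := fun c x hx => ⟨σ.smul_mem c.2 hx.1, by
    have : pairing M (c • x) = (c : ℝ) * pairing M x := by
      change pairing M ((c : ℝ) • x) = _
      rw [map_smul, smul_eq_mul]
    rw [this, hx.2, mul_zero]⟩

theorem mem_faceOf {n : ℕ} {σ : PointedCone ℝ (E n)} {M : Fin n → ℤ} {x : E n} :
    x ∈ faceOf σ M ↔ x ∈ σ ∧ pairing M x = 0 := Iff.rfl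

/-- A multiplicative function on `σ^∨ ∩ ℤⁿ` without zeros in `τ^⊥` is on `τ^⊥` given by
a point of the torus. -/
theorem exists_torus_of_multiplicative {σ τ : PointedCone ℝ (E n)} (hσ : IsRationalPolyhedral σ)
    {M : Fin n → ℤ} (hM : M ∈ dualMonoid σ) (hτ : ∀ x, x ∈ τ ↔ x ∈ σ ∧ pairing M x = 0)
    (γ : (Fin n → ℤ) → ℂ)
    (hadd : ∀ x ∈ dualMonoid σ, ∀ y ∈ dualMonoid σ, γ (x + y) = γ x * γ y)
    (hne : ∀ x ∈ dualMonoid σ, x ∈ perp τ → γ x ≠ 0) :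
    ∃ t : Torus n, ∀ x ∈ dualMonoid σ, x ∈ perp τ → (monomial x t : ℂ) = γ x := by
  have hMτ : M ∈ perp τ := fun u hu => ((hτ u).1 hu).2
  have hkM : ∀ k : ℕ, k • M ∈ dualMonoid σ := fun k => (dualMonoid σ).nsmul_mem hM k
  have hkMτ : ∀ k : ℕ, k • M ∈ perp τ := fun k => (perp τ).nsmul_mem hMτ k
  have hnek : ∀ k : ℕ, γ (k • M) ≠ 0 := fun k => hne _ (hkM k) (hkMτ k)
  have hex : ∀ x : perp τ, ∃ k : ℕ, (x : Fin n → ℤ) + k • M ∈ dualMonoid σ := fun x =>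
    exists_add_nsmul_mem hσ hM hτ (mem_dualMonoid_of_mem_perp x.2)
  choose k hk using hex
  -- Extend `γ` to the group `τ^⊥` by inverting `M`. The quotient does not depend on the multiple of
  -- `M` that is used (`hχ`), and this gives multiplicativity.
  let χ : perp τ → ℂ := fun x => γ (x + k x • M) / γ (k x • M)
  have hχ : ∀ (x : perp τ) (j : ℕ), (x : Fin n → ℤ) + j • M ∈ dualMonoid σ →
      χ x = γ (x + j • M) / γ (j • M) := by
    intro x j hj
    rw [div_eq_div_iff (hnek _) (hnek _), ← hadd _ (hk x) _ (hkM j), ← hadd _ hj _ (hkM _)]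
    congr 1
    abel
  have hχne : ∀ x, χ x ≠ 0 := fun x =>
    div_ne_zero (hne _ (hk x) ((perp τ).add_mem x.2 (hkMτ _))) (hnek _)
  have hχadd : ∀ x y, χ (x + y) = χ x * χ y := by
    intro x y
    have hrw : ((x + y : perp τ) : Fin n → ℤ) + (k x + k y) • M =
        (x + k x • M) + (y + k y • M) := by
      rw [Submodule.coe_add, add_smul]
      abel
    rw [hχ (x + y) (k x + k y) (by rw [hrw]; exact (dualMonoid σ).add_mem (hk x) (hk y)), hrw,
      hadd _ (hk x) _ (hk y), add_smul, hadd _ (hkM _) _ (hkM _), mul_div_mul_comm]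
  let f : perp τ →+ Additive ℂˣ := AddMonoidHom.mk'
    (fun x => Additive.ofMul (Units.mk0 (χ x) (hχne x))) (fun x y => by
      rw [← ofMul_mul]
      congr 1
      exact Units.ext (hχadd x y))
  -- Composing with the retraction of `ℤⁿ` onto `τ^⊥` extends the character to `ℤⁿ`, that is, to a
  -- torus element.
  refine ⟨fun l => (f ⟨retrBasis τ l, retrBasis_mem τ _⟩).toMul, fun x hx hxτ => ?_⟩
  have h1 : f ⟨x, hxτ⟩ = ∑ l, x l • f ⟨retrBasis τ l, retrBasis_mem τ _⟩ := by
    rw [← Finset.sum_congr rfl fun l _ => map_zsmul f _ _, ← map_sum]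
    congr 1
    apply Subtype.ext
    simpa using (sum_smul_retrBasis hxτ).symm
  have h2 : monomial x (fun l => (f ⟨retrBasis τ l, retrBasis_mem τ _⟩).toMul) =
      (f ⟨x, hxτ⟩).toMul := by
    rw [h1, toMul_sum]
    rfl
  rw [h2]
  change χ ⟨x, hxτ⟩ = _
  rw [hχ ⟨x, hxτ⟩ 0 (by simpa using hx)]
  have h0 : γ ((0 : ℕ) • M) = 1 := by
    have := hadd _ (hkM 0) _ (hkM 0)
    rw [zero_smul, add_zero] at this
    have hn := hnek 0
    rw [zero_smul] at hn ⊢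
    exact (mul_eq_left₀ hn).1 this.symm
  rw [h0, zero_smul, add_zero, div_one]

variable {G} in
/-- Every point of the chart of `σ` lies in `O(τ)` for a face `τ` of `σ`. -/
theorem exists_coords_eq {σ : F.cones} {w : Fin (G.k σ) → ℂ} (hw : w ∈ affineToric (G.m σ)) :
    ∃ b : Bordification F, b.1.1 ≤ σ.1 ∧ coords G σ b = w := by
  classical
  have hσ := F.rational σ.1 σ.2
  set γ := charVal (G.m σ) w with hγ
  -- The sum of the generators that do not vanish at `w`; the face it cuts out is the cone whose
  -- component contains `w`.
  let M : Fin n → ℤ := ∑ i with w i ≠ 0, G.m σ i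
  have hM : M ∈ dualMonoid σ.1 := (dualMonoid σ.1).sum_mem fun i _ => G.mem σ i
  have hface : IsFace (faceOf σ.1 M) σ.1 := ⟨pairing M, hM, fun x => mem_faceOf⟩
  let τ : F.cones := ⟨faceOf σ.1 M, F.face_mem σ.1 σ.2 _ hface⟩
  have hτ : ∀ x, x ∈ τ.1 ↔ x ∈ σ.1 ∧ pairing M x = 0 := fun x => mem_faceOf
  have hMτ : ∀ i, w i ≠ 0 → G.m σ i ∈ perp τ.1 := by
    intro i hi u hu
    have hsum : ∑ i with w i ≠ 0, pairing (G.m σ i) u = 0 := by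
      rw [← ((hτ u).1 hu).2]
      simp only [pairing_apply, M, Finset.sum_apply, Int.cast_sum, Finset.sum_mul]
      rw [Finset.sum_comm]
    exact (Finset.sum_eq_zero_iff_of_nonneg fun j _ => G.mem σ j u ((hτ u).1 hu).1).1 hsum i
      (by simpa using hi)
  have hγM : γ M ≠ 0 := by
    have hMsum : M = ∑ i, (if w i ≠ 0 then 1 else 0 : ℕ) • G.m σ i := by
      simp [M, Finset.sum_filter]
    rw [hγ, charVal_eq hw hMsum]
    refine Finset.prod_ne_zero_iff.2 fun i _ => ?_
    by_cases hi : w i = 0 <;> simp [hi]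
  -- For `x ∈ τ^⊥` some `-x + k M` lies in `σ^∨`, and its value times `γ x` is `γ M ^ k ≠ 0`.
  have hne : ∀ x ∈ dualMonoid σ.1, x ∈ perp τ.1 → γ x ≠ 0 := by
    intro x hx hxτ
    obtain ⟨k, hk⟩ := exists_add_nsmul_mem hσ hM hτ
      (mem_dualMonoid_of_mem_perp ((perp τ.1).neg_mem hxτ))
    have h1 := charVal_add hw hx hk
    rw [add_neg_cancel_left, charVal_nsmul hw hM] at h1
    intro h0
    rw [← hγ, h0, zero_mul] at h1
    exact pow_ne_zero k hγM h1
  have hzero : ∀ i, G.m σ i ∉ perp τ.1 → w i = 0 := fun i hi => by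
    by_contra h
    exact hi (hMτ i h)
  obtain ⟨t, ht⟩ := exists_torus_of_multiplicative hσ hM hτ γ
    (fun x hx y hy => charVal_add hw hx hy) hne
  refine ⟨⟨τ, proj τ.1 t⟩, fun x hx => ((hτ x).1 hx).1, ?_⟩
  funext i
  simp only [coords]
  by_cases hi : G.m σ i ∈ perp τ.1
  · rw [evalO_of_mem hi, char_proj (F.rational τ.1 τ.2) hi, ht _ (G.mem σ i) hi, hγ,
      charVal_gen hw]
  · rw [evalO_of_notMem hi, hzero i hi]

theorem evalO_eq_prod {σ : F.cones} {b : Bordification F} (hb : b.1.1 ≤ σ.1) {m : Fin n → ℤ}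
    {a : Fin (G.k σ) → ℕ} (ha : m = ∑ i, a i • G.m σ i) :
    evalO m b.2 = ∏ i, coords G σ b i ^ a i := by
  rw [ha, evalO_sum_nsmul _ _ fun i => dualMonoid_anti hb (G.mem σ i)]
  rfl

variable {G} in
-- The coordinates determine the values of all characters in `σ^∨`. The face is recovered from those
-- that do not vanish. A character `m` in its orthogonal is then the quotient of `m + k M` by `k M`,
-- both in `σ^∨`, where `M` cuts out the face.
theorem coords_injOn {σ : F.cones} {b b' : Bordification F} (hb : b.1.1 ≤ σ.1)
    (hb' : b'.1.1 ≤ σ.1) (h : coords G σ b = coords G σ b') : b = b' := by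
  have hσ := F.rational σ.1 σ.2
  have hev : ∀ m ∈ dualMonoid σ.1, evalO m b.2 = evalO m b'.2 := by
    intro m hm
    obtain ⟨a, ha⟩ := G.exists_eq_sum σ hm
    rw [evalO_eq_prod G hb ha, evalO_eq_prod G hb' ha, h]
  have hle : ∀ {c c' : Bordification F}, c.1.1 ≤ σ.1 → c'.1.1 ≤ σ.1 →
      (∀ m ∈ dualMonoid σ.1, evalO m c.2 = evalO m c'.2) → c.1.1 ≤ c'.1.1 := by
    intro c c' hc hc' hcc x hx
    obtain ⟨M, hM, hcut⟩ := (F.isFace σ.2 c'.1.2 hc').exists_pairing hσ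
    have h1 : evalO M c'.2 ≠ 0 := evalO_ne_zero_iff.2 fun u hu => ((hcut u).1 hu).2
    rw [← hcc M hM, evalO_ne_zero_iff] at h1
    exact (hcut x).2 ⟨hc hx, h1 x hx⟩
  have hfst : b.1 = b'.1 :=
    Subtype.ext (le_antisymm (hle hb hb' hev) (hle hb' hb fun m hm => (hev m hm).symm))
  obtain ⟨τ, p⟩ := b
  obtain ⟨τ', p'⟩ := b'
  obtain rfl : τ = τ' := hfst
  congr 1
  refine O.ext_char (F.rational τ.1 τ.2) fun m hm => ?_
  obtain ⟨M, hM, hcut⟩ := (F.isFace σ.2 τ.2 hb).exists_pairing hσ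
  have hMτ : M ∈ perp τ.1 := fun u hu => ((hcut u).1 hu).2
  obtain ⟨k, hk⟩ := exists_add_nsmul_mem hσ hM hcut (mem_dualMonoid_of_mem_perp hm)
  have hkM := (dualMonoid σ.1).nsmul_mem hM k
  have h1 := hev _ hk
  have h2 := hev _ hkM
  rw [evalO_of_mem ((perp τ.1).nsmul_mem hMτ k), evalO_of_mem ((perp τ.1).nsmul_mem hMτ k)] at h2
  have hmk := (perp τ.1).add_mem hm ((perp τ.1).nsmul_mem hMτ k)
  rw [evalO_of_mem hmk, evalO_of_mem hmk] at h1
  have h1' := Units.ext h1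
  have h2' := Units.ext h2
  simp only [char, monomial_add] at h1' h2' ⊢
  rw [h2'] at h1'
  exact mul_right_cancel h1'

end Charts


/-! ### The toric variety and the bordification -/

section Comparison

variable {n : ℕ} {F : Fan n} (G : Generators F)

/-- The point of the bordification that corresponds to a point of a chart. -/
def toBord {σ : F.cones} (w : G.chart σ) : Bordification F := (exists_coords_eq w.2).choose

theorem toBord_le {σ : F.cones} (w : G.chart σ) : (toBord G w).1.1 ≤ σ.1 :=
  (exists_coords_eq w.2).choose_spec.1

theorem coords_toBord {σ : F.cones} (w : G.chart σ) : coords G σ (toBord G w) = w.1 :=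
  (exists_coords_eq w.2).choose_spec.2

theorem toBord_eq {σ : F.cones} {w : G.chart σ} {b : Bordification F} (hb : b.1.1 ≤ σ.1)
    (h : coords G σ b = w.1) : toBord G w = b :=
  coords_injOn (toBord_le G w) hb ((coords_toBord G w).trans h.symm)

/-- The point of the chart of `σ` that corresponds to a point of the bordification. -/
def toChart {σ : F.cones} (b : Bordification F) (hb : b.1.1 ≤ σ.1) : G.chart σ :=
  ⟨coords G σ b, coords_mem G hb⟩

theorem toBord_toChart {σ : F.cones} (b : Bordification F) (hb : b.1.1 ≤ σ.1) :
    toBord G (toChart G b hb) = b := toBord_eq G hb rfl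

theorem toChart_toBord {σ : F.cones} (w : G.chart σ) {b : Bordification F} (hb : b.1.1 ≤ σ.1)
    (h : toBord G w = b) : toChart G b hb = w := by
  subst h
  exact Subtype.ext (coords_toBord G w)

theorem toBord_injective (σ : F.cones) :
    Function.Injective (toBord G : G.chart σ → Bordification F) := by
  intro w w' h
  apply Subtype.ext
  rw [← coords_toBord, ← coords_toBord, h]

/-- The gluing relation says that the point attached to `w` has coordinates `u` in the larger chart,
and coordinates are injective there. -/
theorem toBord_glue {x y : Σ σ : F.cones, G.chart σ} (h : G.Glue x y) :
    toBord G x.2 = toBord G y.2 := by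
  obtain ⟨τ, σ, w, u, hf, hu⟩ := h
  refine (toBord_eq G ((toBord_le G w).trans hf.le) ?_).symm
  funext i
  obtain ⟨a, ha⟩ := G.exists_eq_sum τ (dualMonoid_anti hf.le (G.mem σ i))
  rw [hu i a ha, ← coords_toBord G w]
  exact evalO_eq_prod G (toBord_le G w) ha

theorem glue_toChart {τ σ : F.cones} (b : Bordification F) (hb : b.1.1 ≤ τ.1) (h : τ.1 ≤ σ.1) :
    G.Glue ⟨τ, toChart G b hb⟩ ⟨σ, toChart G b (hb.trans h)⟩ :=
  .face τ σ _ _ (F.isFace σ.2 τ.2 h) fun _ _ ha => evalO_eq_prod G hb ha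

/-- The bijection between the toric variety and the bordification. -/
def bordEquiv : ToricVariety G ≃ Bordification F where
  toFun := Quot.lift (fun x => toBord G x.2) fun _ _ h => toBord_glue G h
  invFun b := ToricVariety.mk G b.1 (toChart G b le_rfl)
  left_inv x := by
    induction x using Quot.ind with
    | _ x =>
      obtain ⟨σ, w⟩ := x
      -- The inverse uses the smallest chart containing the point, that of its own cone; gluing
      -- carries it to the given chart.
      refine (Quot.sound (glue_toChart G (toBord G w) le_rfl (toBord_le G w))).trans ?_
      rw [toChart_toBord G w _ rfl]
  right_inv b := toBord_toChart G b le_rfl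

theorem bordEquiv_mk {σ : F.cones} (w : G.chart σ) :
    bordEquiv G (ToricVariety.mk G σ w) = toBord G w := rfl

theorem mk_toChart {σ : F.cones} (b : Bordification F) (hb : b.1.1 ≤ σ.1) :
    ToricVariety.mk G σ (toChart G b hb) = (bordEquiv G).symm b := by
  rw [Equiv.eq_symm_apply, bordEquiv_mk, toBord_toChart]

theorem mem_perp_bot (m : Fin n → ℤ) : m ∈ perp (⊥ : PointedCone ℝ (E n)) := by
  intro u hu
  rw [(Submodule.mem_bot _).1 hu, map_zero]

theorem bordEquiv_torus (σ : F.cones) (t : Torus n) :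
    bordEquiv G (ToricVariety.mk G σ ⟨torusMap (G.m σ) t, torusMap_mem _ t⟩) =
      Bordification.ofTorus F t := by
  refine toBord_eq G (show (F.zero.1 : PointedCone ℝ (E n)) ≤ σ.1 from bot_le) ?_
  funext i
  have h : G.m σ i ∈ perp F.zero.1 := mem_perp_bot _
  change evalO (G.m σ i) (proj F.zero.1 t) = _
  rw [evalO_of_mem h, char_proj (F.rational _ F.zero.2) h]
  rfl

theorem bordEquiv_ofTorus (t : Torus n) :
    bordEquiv G (ToricVariety.ofTorus G t) = Bordification.ofTorus F t :=
  bordEquiv_torus G F.zero t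

theorem ofTorus_eq_mk (σ : F.cones) (t : Torus n) : ToricVariety.ofTorus G t =
    ToricVariety.mk G σ ⟨torusMap (G.m σ) t, torusMap_mem _ t⟩ :=
  (bordEquiv G).injective ((bordEquiv_ofTorus G t).trans (bordEquiv_torus G σ t).symm)

theorem bordEquiv_smul (t : Torus n) (x : ToricVariety G) :
    bordEquiv G (t • x) = t • bordEquiv G x := by
  induction x using Quot.ind with
  | _ x =>
    obtain ⟨σ, w⟩ := x
    change toBord G (G.act σ t w) = t • toBord G w
    refine toBord_eq G (toBord_le G w) ?_
    funext i
    change evalO (G.m σ i) (proj _ t + (toBord G w).2) = monomial (G.m σ i) t * w.1 i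
    rw [evalO_proj_add (F.rational _ (toBord G w).1.2), ← coords_toBord G w]
    rfl

/-! ### The charts are open -/

theorem continuous_evalO_toBord {σ : F.cones} {m : Fin n → ℤ} (hm : m ∈ dualMonoid σ.1) :
    Continuous fun w : G.chart σ => evalO m (toBord G w).2 := by
  obtain ⟨a, ha⟩ := G.exists_eq_sum σ hm
  have : (fun w : G.chart σ => evalO m (toBord G w).2) = fun w => ∏ i, w.1 i ^ a i := by
    funext w
    rw [evalO_eq_prod G (toBord_le G w) ha, coords_toBord]
  rw [this]
  exact continuous_finsetProd _ fun i _ =>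
    ((continuous_apply i).comp continuous_subtype_val).pow (a i)

/-- The inclusion of charts `U_τ ⊆ U_σ` for a face `τ` of `σ`. -/
def chartIncl {τ σ : F.cones} (h : τ.1 ≤ σ.1) (w : G.chart τ) : G.chart σ :=
  toChart G (toBord G w) ((toBord_le G w).trans h)

theorem continuous_chartIncl {τ σ : F.cones} (h : τ.1 ≤ σ.1) : Continuous (chartIncl G h) :=
  Continuous.subtype_mk (continuous_pi fun i =>
    continuous_evalO_toBord G (dualMonoid_anti h (G.mem σ i))) _

theorem toBord_chartIncl {τ σ : F.cones} (h : τ.1 ≤ σ.1) (w : G.chart τ) :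
    toBord G (chartIncl G h w) = toBord G w := toBord_toChart G _ _

/-- If `M` cuts out `τ`, then `U_τ` is the open subset of `U_σ` where the character `M` does not
vanish. There the coordinates of `U_τ` are the continuous quotients of `m'_j + k_j M` by the
`k_j`-th power of `M`. -/
theorem isOpenMap_chartIncl {τ σ : F.cones} (h : τ.1 ≤ σ.1) : IsOpenMap (chartIncl G h) := by
  rintro _ ⟨V, hV, rfl⟩
  have hσ := F.rational σ.1 σ.2
  obtain ⟨M, hM, hcut⟩ := (F.isFace σ.2 τ.2 h).exists_pairing hσ
  choose k hk using fun j => exists_add_nsmul_mem hσ hM hcut (G.mem τ j)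
  let ψ : G.chart σ → Fin (G.k τ) → ℂ := fun u j =>
    evalO (G.m τ j + k j • M) (toBord G u).2 / evalO M (toBord G u).2 ^ k j
  have hMcont := continuous_evalO_toBord G hM
  have hψ : ContinuousOn ψ {u | evalO M (toBord G u).2 ≠ 0} := by
    refine continuousOn_pi.2 fun j => ContinuousOn.div
      (continuous_evalO_toBord G (hk j)).continuousOn (hMcont.pow _).continuousOn fun u hu =>
        pow_ne_zero _ hu
  have hopen := hψ.isOpen_inter_preimage (isOpen_ne_fun hMcont continuous_const) hV
  have hψeq : ∀ u : G.chart σ, (hu : (toBord G u).1.1 ≤ τ.1) → ψ u = coords G τ (toBord G u) := by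
    intro u hu
    have hMp : M ∈ perp (toBord G u).1.1 := fun x hx => ((hcut x).1 (hu hx)).2
    have hMd := mem_dualMonoid_of_mem_perp hMp
    funext j
    simp only [ψ, coords]
    rw [evalO_add (dualMonoid_anti hu (G.mem τ j)) ((dualMonoid _).nsmul_mem hMd _),
      evalO_nsmul hMd, mul_div_cancel_right₀]
    exact pow_ne_zero _ (evalO_ne_zero_iff.2 hMp)
  convert hopen using 1
  ext u
  constructor
  · rintro ⟨w, hw, rfl⟩
    have hle : (toBord G (chartIncl G h w)).1.1 ≤ τ.1 := by
      rw [toBord_chartIncl]; exact toBord_le G w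
    refine ⟨evalO_ne_zero_iff.2 fun x hx => ((hcut x).1 (hle hx)).2, ?_⟩
    rw [Set.mem_preimage, hψeq _ hle, toBord_chartIncl, coords_toBord]
    exact hw
  · rintro ⟨hu, huV⟩
    have hle : (toBord G u).1.1 ≤ τ.1 := fun x hx =>
      (hcut x).2 ⟨toBord_le G u hx, evalO_ne_zero_iff.1 hu x hx⟩
    rw [Set.mem_preimage, hψeq u hle] at huV
    refine ⟨toChart G (toBord G u) hle, huV, toBord_injective G σ ?_⟩
    rw [toBord_chartIncl, toBord_toChart]

/-- A point common to `U_σ` and `U_τ` lies in a component whose cone is contained in `σ ∩ τ`. So the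
trace on `U_τ` of an open `W ⊆ U_σ` is the image, under the open inclusion of `U_{σ ∩ τ}`, of the
preimage of `W`. -/
theorem isOpenEmbedding_mk (σ : F.cones) : IsOpenEmbedding (ToricVariety.mk G σ) := by
  refine .of_continuous_injective_isOpenMap ?_ ?_ ?_
  · exact continuous_quot_mk.comp continuous_sigmaMk
  · intro w w' h
    exact toBord_injective G σ (congrArg (bordEquiv G) h)
  · intro W hW
    have hq : IsQuotientMap (Quot.mk G.Glue) := isQuotientMap_quot_mk
    refine hq.isOpen_preimage.1 (isOpen_sigma_iff.2 fun τ => ?_)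
    let ρ : F.cones := ⟨σ.1 ⊓ τ.1, F.face_mem _ σ.2 _ (F.inter_face _ σ.2 _ τ.2).1⟩
    have hρσ : ρ.1 ≤ σ.1 := inf_le_left
    have hρτ : ρ.1 ≤ τ.1 := inf_le_right
    convert isOpenMap_chartIncl G hρτ _ (hW.preimage (continuous_chartIncl G hρσ)) using 1
    ext u
    constructor
    · rintro ⟨w, hw, hwu⟩
      have hb : toBord G w = toBord G u := congrArg (bordEquiv G) hwu
      have hle : (toBord G u).1.1 ≤ ρ.1 := le_inf (hb ▸ toBord_le G w) (toBord_le G u)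
      refine ⟨toChart G (toBord G u) hle, ?_, toBord_injective G τ ?_⟩
      · have : chartIncl G hρσ (toChart G (toBord G u) hle) = w := by
          apply toBord_injective G σ
          rw [toBord_chartIncl, toBord_toChart, hb]
        rw [Set.mem_preimage, this]
        exact hw
      · rw [toBord_chartIncl, toBord_toChart]
    · rintro ⟨v, hv, rfl⟩
      refine ⟨chartIncl G hρσ v, hv, (bordEquiv G).injective ?_⟩
      change toBord G (chartIncl G hρσ v) = toBord G (chartIncl G hρτ v)
      rw [toBord_chartIncl, toBord_chartIncl]

/-! ### Local compactness, countability, density of the torus and the Hausdorff property -/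

theorem isClosed_affineToric {n k : ℕ} (m : Fin k → Fin n → ℤ) : IsClosed (affineToric m) := by
  have : affineToric m = ⋂ (p : MvPolynomial (Fin k) ℂ)
      (_ : ∀ v ∈ Set.range (torusMap m), MvPolynomial.eval v p = 0),
      {w | MvPolynomial.eval w p = 0} := by
    ext w
    simp only [affineToric, zariskiClosure, Set.mem_ofPred_eq, Set.mem_iInter]
  rw [this]
  exact isClosed_iInter fun p => isClosed_iInter fun _ =>
    isClosed_eq (MvPolynomial.continuous_eval p) continuous_const

theorem exists_mk_eq (x : ToricVariety G) : ∃ σ, ∃ w : G.chart σ, ToricVariety.mk G σ w = x := by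
  induction x using Quot.ind with
  | _ x => exact ⟨x.1, x.2, rfl⟩

instance : WeaklyLocallyCompactSpace (ToricVariety G) where
  exists_compact_mem_nhds x := by
    obtain ⟨σ, w, rfl⟩ := exists_mk_eq G x
    have : LocallyCompactSpace (G.chart σ) := (isClosed_affineToric (G.m σ)).locallyCompactSpace
    obtain ⟨K, hK, hKw⟩ := exists_compact_mem_nhds w
    exact ⟨_, hK.image (isOpenEmbedding_mk G σ).continuous,
      (isOpenEmbedding_mk G σ).isOpenMap.image_mem_nhds hKw⟩

instance : FirstCountableTopology (ToricVariety G) where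
  nhds_generated_countable x := by
    obtain ⟨σ, w, rfl⟩ := exists_mk_eq G x
    rw [← (isOpenEmbedding_mk G σ).map_nhds_eq]
    infer_instance

/-- Convergence of sequences of the torus in the toric variety. -/
theorem tendsto_ofTorus_iff (z : ℕ → Torus n) (x : ToricVariety G) :
    Tendsto (fun j => ToricVariety.ofTorus G (z j)) atTop (𝓝 x) ↔
      ConvergesTo z (bordEquiv G x).1.1 (bordEquiv G x).2 := by
  obtain ⟨b, rfl⟩ := (bordEquiv G).symm.surjective x
  rw [Equiv.apply_symm_apply, convergesTo_iff_monomial (F.rational _ b.1.2),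
    ← mk_toChart G b le_rfl]
  simp only [ofTorus_eq_mk G b.1]
  have h1 := (isOpenEmbedding_mk G b.1).isInducing.tendsto_nhds_iff (l := atTop)
    (f := fun j => ⟨torusMap (G.m b.1) (z j), torusMap_mem _ (z j)⟩)
    (y := toChart G b le_rfl)
  simp only [Function.comp_def] at h1
  rw [← h1, tendsto_subtype_rng, tendsto_pi_nhds]
  -- Chart coordinates are only the generators; the other characters are monomials in them.
  refine ⟨fun h m hm => ?_, fun h i => h _ (G.mem b.1 i)⟩
  obtain ⟨a, rfl⟩ := G.exists_eq_sum b.1 hm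
  rw [evalO_sum_nsmul _ _ fun i => G.mem b.1 i]
  simp only [monomial_sum, Units.coe_prod, Units.val_pow_eq_pow_val]
  exact tendsto_finsetProd _ fun i _ => (h i).pow (a i)

theorem denseRange_ofTorus : DenseRange (ToricVariety.ofTorus G) := by
  intro x
  obtain ⟨z, hz⟩ := exists_convergesTo (F.rational _ (bordEquiv G x).1.2) (bordEquiv G x).2
  exact mem_closure_of_tendsto ((tendsto_ofTorus_iff G z x).2 hz)
    (Eventually.of_forall fun j => ⟨z j, rfl⟩)

/-- The real parts determine the cone, since cones of the fan can be separated, and `O(σ)` is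
Hausdorff. -/
theorem ConvergesTo.unique {z : ℕ → Torus n} {b b' : Bordification F}
    (h : ConvergesTo z b.1.1 b.2) (h' : ConvergesTo z b'.1.1 b'.2) : b = b' := by
  obtain ⟨σ, p⟩ := b
  obtain ⟨τ, q⟩ := b'
  rw [convergesTo_iff] at h h'
  obtain rfl : σ = τ := Subtype.ext (h.1.unique F σ.2 τ.2 h'.1)
  have := O.t2Space (F.rational σ.1 σ.2)
  congr 1
  exact tendsto_nhds_unique h.2 h'.2

/-- If `x` and `y` could not be separated, density of the torus and first countability would give
one sequence in `T` converging to both. -/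
instance : T2Space (ToricVariety G) := by
  refine t2_iff_nhds.2 fun {x y} hxy => ?_
  have hne : (comap (ToricVariety.ofTorus G) (𝓝 x ⊓ 𝓝 y)).NeBot := by
    refine comap_neBot_iff.2 fun t ht => ?_
    obtain ⟨U, hU, V, hV, rfl⟩ := mem_inf_iff.1 ht
    have hUV : interior U ∩ interior V ∈ 𝓝 x ⊓ 𝓝 y :=
      inter_mem_inf (interior_mem_nhds.2 hU) (interior_mem_nhds.2 hV)
    obtain ⟨a, ha⟩ := (denseRange_ofTorus G).exists_mem_open
      (isOpen_interior.inter isOpen_interior) (hxy.nonempty_of_mem hUV)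
    exact ⟨a, interior_subset ha.1, interior_subset ha.2⟩
  obtain ⟨z, hz⟩ := exists_seq_tendsto (comap (ToricVariety.ofTorus G) (𝓝 x ⊓ 𝓝 y))
  have hz' := tendsto_comap_iff.1 hz
  exact (bordEquiv G).injective (ConvergesTo.unique
    ((tendsto_ofTorus_iff G z x).1 (hz'.mono_right inf_le_left))
    ((tendsto_ofTorus_iff G z y).1 (hz'.mono_right inf_le_right)))

/-! ### Comparison of the two topologies -/

/-- The topology of a regular space is generated by the complements of the closures of the subsets
of a dense set. -/
theorem eq_generateFrom_compl_closure {ι X : Type*} [t : TopologicalSpace X] [RegularSpace X]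
    {D : ι → X} (hD : DenseRange D) :
    t = TopologicalSpace.generateFrom {U | ∃ A : Set ι, U = (closure (D '' A))ᶜ} := by
  apply le_antisymm
  · refine le_generateFrom ?_
    rintro _ ⟨A, rfl⟩
    exact isClosed_closure.isOpen_compl
  · intro U hU
    refine (@isOpen_iff_forall_mem_open X (TopologicalSpace.generateFrom _) U).2 fun x hx => ?_
    -- Take for `A` the part of the dense set outside a closed neighbourhood `V ⊆ U` of `x`. As `Vᶜ`
    -- is open, the closure of `A` is that of `Vᶜ`, and its complement is the interior of `V`.
    obtain ⟨V, hV, hVc, hVU⟩ := exists_mem_nhds_isClosed_subset (hU.mem_nhds hx)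
    have hcl : closure (D '' (D ⁻¹' Vᶜ)) = closure Vᶜ := by
      rw [Set.image_preimage_eq_inter_range]
      exact (closure_mono Set.inter_subset_left).antisymm
        (closure_minimal (hD.open_subset_closure_inter hVc.isOpen_compl) isClosed_closure)
    refine ⟨(closure (D '' (D ⁻¹' Vᶜ)))ᶜ, ?_, .basic _ ⟨_, rfl⟩, ?_⟩
    · rw [hcl]
      exact (Set.compl_subset_comm.1 subset_closure).trans hVU
    · rw [hcl, ← interior_compl, compl_compl]
      exact mem_interior_iff_mem_nhds.2 hV

theorem preimage_limits (A : Set (Torus n)) :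
    bordEquiv G ⁻¹' Bordification.limits F A = closure (ToricVariety.ofTorus G '' A) := by
  ext x
  rw [mem_closure_iff_seq_limit]
  constructor
  · rintro ⟨z, hzA, hz⟩
    exact ⟨_, fun j => ⟨z j, hzA j, rfl⟩, (tendsto_ofTorus_iff G z x).2 hz⟩
  · rintro ⟨y, hy, hyx⟩
    choose z hzA hz using hy
    refine ⟨z, hzA, (tendsto_ofTorus_iff G z x).1 ?_⟩
    simpa only [hz] using hyx

/-- `X_Σ` is locally compact and Hausdorff, hence regular. Both topologies are thus generated by
complements of sets that `preimage_limits` identifies. -/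
theorem isInducing_bordEquiv : IsInducing (bordEquiv G) := by
  refine ⟨?_⟩
  change _ = TopologicalSpace.induced _ (TopologicalSpace.generateFrom _)
  rw [induced_generateFrom_eq]
  refine (eq_generateFrom_compl_closure (denseRange_ofTorus G)).trans ?_
  congr 1
  ext U
  constructor
  · rintro ⟨A, rfl⟩
    exact ⟨_, ⟨A, rfl⟩, by rw [Set.preimage_compl, preimage_limits]⟩
  · rintro ⟨_, ⟨A, rfl⟩, rfl⟩
    exact ⟨A, by rw [Set.preimage_compl, preimage_limits]⟩

/-! ### The orbits -/

/-- The component `O(σ)` in the chart of `σ`. -/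
def orbitChart (σ : F.cones) (p : O σ.1) : G.chart σ :=
  toChart G (Bordification.incl F σ p) (le_refl σ.1)

theorem toBord_orbitChart (σ : F.cones) (p : O σ.1) :
    toBord G (orbitChart G σ p) = Bordification.incl F σ p :=
  toBord_toChart G (Bordification.incl F σ p) (le_refl σ.1)

theorem continuous_evalO {σ : PointedCone ℝ (E n)} (hσ : IsRationalPolyhedral σ)
    (m : Fin n → ℤ) : Continuous (evalO m : O σ → ℂ) := by
  by_cases h : m ∈ perp σ
  · have : (evalO m : O σ → ℂ) = fun p => (char m p : ℂ) := funext (evalO_of_mem h)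
    rw [this]
    exact Units.continuous_val.comp (continuous_char hσ h)
  · have : (evalO m : O σ → ℂ) = fun _ => 0 := funext (evalO_of_notMem h)
    rw [this]
    exact continuous_const

/-- Characters in `σ^⊥` have no zeros on `U_σ`, as they are orthogonal to every face of `σ`. They
define a continuous retraction of the whole chart onto `O(σ)`. -/
theorem isEmbedding_orbitChart (σ : F.cones) : IsEmbedding (orbitChart G σ) := by
  have hσ := F.rational σ.1 σ.2
  let g : G.chart σ → O σ.1 := fun w => proj σ.1 fun l => char (retrBasis σ.1 l) (toBord G w).2
  refine .of_leftInverse (f := g) (fun p => ?_) ?_ ?_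
  · change proj σ.1 (fun l => char (retrBasis σ.1 l) (toBord G (orbitChart G σ p)).2) = p
    rw [toBord_orbitChart]
    exact proj_sec hσ p
  · refine (continuous_proj σ.1).comp (continuous_pi fun l =>
      Units.isEmbedding_val₀.continuous_iff.2 ?_)
    convert continuous_evalO_toBord G
      (mem_dualMonoid_of_mem_perp (retrBasis_mem σ.1 l)) using 2 with w
    exact (evalO_of_mem (perp_anti (toBord_le G w) (retrBasis_mem σ.1 l)) _).symm
  · exact Continuous.subtype_mk (continuous_pi fun i => continuous_evalO hσ _) _

theorem bordEquiv_distinguished (σ : F.cones) :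
    bordEquiv G (ToricVariety.distinguished G σ) = Bordification.incl F σ 0 := by
  refine toBord_eq G (show σ.1 ≤ σ.1 from le_rfl) ?_
  funext i
  change evalO (G.m σ i) (0 : O σ.1) = ToricVariety.distinguishedVec G σ i
  by_cases h : G.m σ i ∈ perp σ.1
  · rw [evalO_of_mem h, ← proj_one σ.1, char_proj (F.rational _ σ.2) h, monomial_one,
      Units.val_one]
    exact (if_pos h).symm
  · rw [evalO_of_notMem h]
    exact (if_neg h).symm

theorem range_orbit (σ : F.cones) :
    Set.range (fun p => ToricVariety.mk G σ (orbitChart G σ p)) = ToricVariety.orb G σ := by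
  ext x
  constructor
  · rintro ⟨p, rfl⟩
    obtain ⟨t, rfl⟩ := proj_surjective σ.1 p
    refine ⟨t, (bordEquiv G).injective ?_⟩
    change bordEquiv G (t • _) = _
    rw [bordEquiv_smul, bordEquiv_distinguished, bordEquiv_mk, toBord_orbitChart]
    change (⟨σ, proj σ.1 t + 0⟩ : Σ σ : F.cones, O σ.1) = ⟨σ, proj σ.1 t⟩
    rw [add_zero]
  · rintro ⟨t, rfl⟩
    refine ⟨proj σ.1 t, (bordEquiv G).injective ?_⟩
    change _ = bordEquiv G (t • _)
    rw [bordEquiv_smul, bordEquiv_distinguished, bordEquiv_mk, toBord_orbitChart]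
    change (⟨σ, proj σ.1 t⟩ : Σ σ : F.cones, O σ.1) = ⟨σ, proj σ.1 t + 0⟩
    rw [add_zero]

/-- The orbit of the distinguished point is homeomorphic to `O(σ)`. -/
def orbHomeomorph (σ : F.cones) : ToricVariety.orb G σ ≃ₜ O σ.1 :=
  (Homeomorph.setCongr (range_orbit G σ)).symm.trans
    ((isOpenEmbedding_mk G σ).isEmbedding.comp (isEmbedding_orbitChart G σ)).toHomeomorph.symm

theorem incl_orbHomeomorph (σ : F.cones) (x : ToricVariety.orb G σ) :
    bordEquiv G x = Bordification.incl F σ (orbHomeomorph G σ x) := by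
  obtain ⟨p, rfl⟩ := (orbHomeomorph G σ).symm.surjective x
  rw [Homeomorph.apply_symm_apply]
  exact toBord_orbitChart G σ p

end Comparison

end Toric

end

theorem proposition2p6 (n : ℕ) (F : Toric.Fan n) (G : Toric.Generators F) :
    -- convergence of interior sequences in the topology of the bordification is as prescribed
    (∀ (z : ℕ → Toric.Torus n) (σ : F.cones) (p : Toric.O σ.1),
      Tendsto (fun j => Toric.Bordification.ofTorus F (z j)) atTop
        (𝓝 (Toric.Bordification.incl F σ p)) ↔ Toric.ConvergesTo z σ.1 p) ∧
    ∃ f : Toric.ToricVariety G ≃ₜ Toric.Bordification F,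
      -- `f` extends the identity of the torus
      (∀ t : Toric.Torus n,
        f (Toric.ToricVariety.ofTorus G t) = Toric.Bordification.ofTorus F t) ∧
      -- `f` is equivariant
      (∀ (t : Toric.Torus n) (x : Toric.ToricVariety G), f (t • x) = t • f x) ∧
      -- `f` maps each orbit homeomorphically onto the corresponding boundary component
      ∀ σ : F.cones, ∃ g : Toric.ToricVariety.orb G σ ≃ₜ Toric.O σ.1,
        ∀ x : Toric.ToricVariety.orb G σ,
          f x = Toric.Bordification.incl F σ (g x) := by
  refine ⟨fun z σ p => ?_,
    (Toric.bordEquiv G).toHomeomorphOfIsInducing (Toric.isInducing_bordEquiv G),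
    Toric.bordEquiv_ofTorus G, Toric.bordEquiv_smul G,
    fun σ => ⟨Toric.orbHomeomorph G σ, Toric.incl_orbHomeomorph G σ⟩⟩
  have h := Toric.tendsto_ofTorus_iff G z ((Toric.bordEquiv G).symm (Toric.Bordification.incl F σ p))
  rw [(Toric.isInducing_bordEquiv G).tendsto_nhds_iff] at h
  simp only [Function.comp_def, Toric.bordEquiv_ofTorus] at h
  rwa [Equiv.apply_symm_apply] at h
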